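/- Let $n\ge 1$, let $R$ be an integral domain with $\operatorname{char}(R)\nmid n$, and let $A=R[\mathbb{Z}/n\mathbb{Z}]\cong R[\sigma]/(\sigma^n-1)$. Let $HH^*(A;A)$ be the Hochschild cohomology of $A$ over $R$, computed by the normalized Hochschild cochains $f\in \mathrm{Hom}_R(\bar A^{\otimes m},A)$, $\bar A=A/R$, with the cup product $(f\smile g)(a_1,\dots,a_{k+l})=f(a_1,\dots,a_k)\,g(a_{k+1},\dots,a_{k+l})$ and the Gerstenhaber bracket induced by $\{f,g\}=f\circ g-(-1)^{(|f|-1)(|g|-1)}g\circ f$, where for $|f|=k$, $|g|=l$ $$(f\circ g)(a_1,\dots,a_{k+l-1})=\sum_{i=1}^{k}(-1)^{(l-1)(i-1)}f(a_1,\dots,a_{i-1},g(a_i,\dots,a_{i+l-1}),a_{i+l},\dots,a_{k+l-1}).$$ Let $\langle a,b\rangle=\varepsilon(ab)$ be the canonical Frobenius form of the group ring, where $\varepsilon(\sum_g\alpha_g g)=\alpha_e$, and let $$\Delta(f)(a_1,\dots,a_m)=\sum_{g\in \mathbb{Z}/n\mathbb{Z}}\ \sum_{i=0}^{m}(-1)^{im}\,\langle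 1,f(a_i,\dots,a_m,g,a_1,\dots,a_{i-1})\rangle\, g^{-1}$$ for a cochain $f$ of degree $m+1$ (the arguments of $f$ are the cyclic rotation by $i$ places of $(g,a_1,\dots,a_m)$, so the term $i=0$ is $f(g,a_1,\dots,a_m)$), and $\Delta=0$ in degree $0$. Then the bracket and $\Delta$ are well defined on $HH^*(A;A)$ and make it, with the cup product, a Batalin--Vilkovisky algebra: a graded commutative algebra with a Lie bracket of degree $-1$ that satisfies the Poisson identity, and with $\Delta$ of degree $-1$ such that $\Delta\circ\Delta=0$ and $\{a,b\}=-(-1)^{|a|}(\Delta(ab)-\Delta(a)b-(-1)^{|a|}a\Delta(b))$. This Batalin--Vilkovisky algebra is given by $$HH^*(A;A)\cong R[x,z]/(x^n-1,\,nz)\quad\text{as graded $R$-algebras, with } |x|=0,\ |z|=2,$$ $$\Delta(a)=0\quad\text{for all } a\in HH^*(A;A).$$ -/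

import Mathlib

open scoped DirectSum

noncomputable section

namespace Hochschild

/-! ## Multilinear maps obtained by substitution -/

section Multilinear

variable {R A : Type*} [CommRing R] [Ring A] [Algebra R A]

/-- The multilinear map `a ↦ f (v a)`, for a substitution `v` of argument vectors in which every
argument enters exactly one slot, and enters it linearly. -/
def subst {m n : ℕ} (f : MultilinearMap R (fun _ : Fin n => A) A)
    (v : (Fin m → A) → Fin n → A)
    (hv : ∀ (a : Fin m → A) (i : Fin m), ∃ (q : Fin n) (L : A →ₗ[R] A),
      ∀ x, v (Function.update a i x) = Function.update (v a) q (L x)) :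
    MultilinearMap R (fun _ : Fin m => A) A where
  toFun a := f (v a)
  map_update_add' := by
    intro inst a i x y
    obtain rfl : inst = instDecidableEqFin m := Subsingleton.elim _ _
    obtain ⟨q, L, h⟩ := hv a i
    simp only [h, map_add, f.map_update_add]
  map_update_smul' := by
    intro inst a i c x
    obtain rfl : inst = instDecidableEqFin m := Subsingleton.elim _ _
    obtain ⟨q, L, h⟩ := hv a i
    simp only [h, map_smul, f.map_update_smul]

@[simp] theorem subst_apply {m n : ℕ} (f : MultilinearMap R (fun _ : Fin n => A) A)
    (v : (Fin m → A) → Fin n → A) (hv) (a : Fin m → A) : subst f v hv a = f (v a) := rfl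

/-- The product `a ↦ f (a ∘ s) * g (a ∘ t)` of two multilinear maps in complementary sets of
variables. -/
def prodMap {k l m : ℕ} (f : MultilinearMap R (fun _ : Fin k => A) A)
    (g : MultilinearMap R (fun _ : Fin l => A) A) (s : Fin k → Fin m) (t : Fin l → Fin m)
    (hst : ∀ i : Fin m, (∃ p, (∀ q, s q = i ↔ q = p) ∧ ∀ q, t q ≠ i) ∨
      (∃ p, (∀ q, t q = i ↔ q = p) ∧ ∀ q, s q ≠ i)) :
    MultilinearMap R (fun _ : Fin m => A) A where
  toFun a := f (fun p => a (s p)) * g (fun p => a (t p))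
  map_update_add' := by
    intro inst a i x y
    obtain rfl : inst = instDecidableEqFin m := Subsingleton.elim _ _
    have key : ∀ {n : ℕ} (r : Fin n → Fin m) (p : Fin n), (∀ q, r q = i ↔ q = p) →
        ∀ x : A, (fun q => Function.update a i x (r q)) =
          Function.update (fun q => a (r q)) p x := by
      intro n r p h x
      funext q
      simp only [Function.update_apply, h]
    have key' : ∀ {n : ℕ} (r : Fin n → Fin m), (∀ q, r q ≠ i) →
        ∀ x : A, (fun q => Function.update a i x (r q)) = fun q => a (r q) := by
      intro n r h x
      funext q
      simp only [Function.update_apply, h, if_false]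
    rcases hst i with ⟨p, h, h'⟩ | ⟨p, h, h'⟩
    · simp only [key s p h, key' t h', f.map_update_add, add_mul]
    · simp only [key t p h, key' s h', g.map_update_add, mul_add]
  map_update_smul' := by
    intro inst a i c x
    obtain rfl : inst = instDecidableEqFin m := Subsingleton.elim _ _
    have key : ∀ {n : ℕ} (r : Fin n → Fin m) (p : Fin n), (∀ q, r q = i ↔ q = p) →
        ∀ x : A, (fun q => Function.update a i x (r q)) =
          Function.update (fun q => a (r q)) p x := by
      intro n r p h x
      funext q
      simp only [Function.update_apply, h]
    have key' : ∀ {n : ℕ} (r : Fin n → Fin m), (∀ q, r q ≠ i) →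
        ∀ x : A, (fun q => Function.update a i x (r q)) = fun q => a (r q) := by
      intro n r h x
      funext q
      simp only [Function.update_apply, h, if_false]
    rcases hst i with ⟨p, h, h'⟩ | ⟨p, h, h'⟩
    · simp only [key s p h, key' t h', f.map_update_smul, smul_mul_assoc]
    · simp only [key t p h, key' s h', g.map_update_smul, mul_smul_comm]

/-- Evaluation on an infinite sequence, of which only the first `n` entries matter. -/
def ev {n : ℕ} (f : MultilinearMap R (fun _ : Fin n => A) A) (a : ℕ → A) : A :=
  f (fun i => a i)

theorem ev_ext {n : ℕ} {f g : MultilinearMap R (fun _ : Fin n => A) A}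
    (h : ∀ a : ℕ → A, ev f a = ev g a) : f = g := by
  ext a
  have h' := h (fun i => if hi : i < n then a ⟨i, hi⟩ else 0)
  simpa [ev] using h'

theorem ev_congr {n : ℕ} (f : MultilinearMap R (fun _ : Fin n => A) A) {a b : ℕ → A}
    (h : ∀ i < n, a i = b i) : ev f a = ev f b := by
  unfold ev
  congr 1
  funext i
  exact h i i.2

/-- `(x_0, …, x_n) ↦ (x_0, …, x_j x_{j+1}, …, x_n)`. -/
def merge {n : ℕ} (j : Fin n) (a : Fin (n + 1) → A) : Fin n → A := fun p =>
  if p < j then a p.castSucc else if p = j then a p.castSucc * a p.succ else a p.succ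

theorem merge_update {n : ℕ} (j : Fin n) (a : Fin (n + 1) → A) (i : Fin (n + 1)) :
    ∃ (q : Fin n) (L : A →ₗ[R] A),
      ∀ x, merge j (Function.update a i x) = Function.update (merge j a) q (L x) := by
  rcases lt_trichotomy (i : ℕ) (j : ℕ) with h | h | h
  · refine ⟨⟨i, by omega⟩, LinearMap.id, fun x => ?_⟩
    funext p
    simp only [merge, Function.update_apply, Fin.ext_iff, Fin.lt_def, LinearMap.id_apply,
      Fin.val_castSucc, Fin.val_succ]
    grind
  · refine ⟨j, LinearMap.mulRight R (a j.succ), fun x => ?_⟩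
    funext p
    simp only [merge, Function.update_apply, Fin.ext_iff, Fin.lt_def, LinearMap.mulRight_apply,
      Fin.val_castSucc, Fin.val_succ]
    split_ifs <;> first | omega | rfl | skip
    congr 2
    ext; simp; omega
  · by_cases h2 : (i : ℕ) = j + 1
    · refine ⟨j, LinearMap.mulLeft R (a j.castSucc), fun x => ?_⟩
      funext p
      simp only [merge, Function.update_apply, Fin.ext_iff, Fin.lt_def, LinearMap.mulLeft_apply,
        Fin.val_castSucc, Fin.val_succ]
      split_ifs <;> first | omega | rfl | skip
      congr 2
      ext; simp; omega
    · refine ⟨⟨i - 1, by omega⟩, LinearMap.id, fun x => ?_⟩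
      funext p
      simp only [merge, Function.update_apply, Fin.ext_iff, Fin.lt_def, LinearMap.id_apply,
        Fin.val_castSucc, Fin.val_succ]
      split_ifs <;> first | omega | rfl

end Multilinear

/-! ## The normalized Hochschild complex -/

section Complex

variable {R A : Type*} [CommRing R] [Ring A] [Algebra R A]

/-- The identity of `A` as a multilinear map in one variable. -/
def oneVar : MultilinearMap R (fun _ : Fin 1 => A) A :=
  MultilinearMap.ofSubsingleton R A A (0 : Fin 1) LinearMap.id

/-- `(x_0, …, x_n) ↦ x_0 * f (x_1, …, x_n)`. -/
def leftFace {n : ℕ} (f : MultilinearMap R (fun _ : Fin n => A) A) :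
    MultilinearMap R (fun _ : Fin (n + 1) => A) A :=
  prodMap oneVar f (fun _ => 0) Fin.succ (by
    intro i
    refine Fin.cases ?_ (fun j => ?_) i
    · exact Or.inl ⟨0, fun q => by simp [Subsingleton.elim q 0], fun q => Fin.succ_ne_zero q⟩
    · exact Or.inr ⟨j, fun q => Fin.succ_inj, fun q => (Fin.succ_ne_zero j).symm⟩)

/-- `(x_0, …, x_n) ↦ f (x_0, …, x_{n-1}) * x_n`. -/
def rightFace {n : ℕ} (f : MultilinearMap R (fun _ : Fin n => A) A) :
    MultilinearMap R (fun _ : Fin (n + 1) => A) A :=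
  prodMap f oneVar Fin.castSucc (fun _ => Fin.last n) (by
    intro i
    refine Fin.lastCases ?_ (fun j => ?_) i
    · exact Or.inr ⟨0, fun q => by simp [Subsingleton.elim q 0], fun q => (Fin.castSucc_lt_last q).ne⟩
    · exact Or.inl ⟨j, fun q => Fin.castSucc_inj, fun q => (Fin.castSucc_lt_last j).ne'⟩)

/-- The Hochschild differential
`(df)(x_0, …, x_n) = x_0 f(x_1, …, x_n) + ∑_{j<n} (-1)^(j+1) f(…, x_j x_{j+1}, …)
  + (-1)^(n+1) f(x_0, …, x_{n-1}) x_n`. -/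
def diff {n : ℕ} (f : MultilinearMap R (fun _ : Fin n => A) A) :
    MultilinearMap R (fun _ : Fin (n + 1) => A) A :=
  leftFace f + ∑ j : Fin n, (-1 : R) ^ ((j : ℕ) + 1) • subst f (merge j) (merge_update j) +
    (-1 : R) ^ (n + 1) • rightFace f

theorem diff_apply {n : ℕ} (f : MultilinearMap R (fun _ : Fin n => A) A) (a : Fin (n + 1) → A) :
    diff f a = a 0 * f (fun i => a i.succ) +
      ∑ j : Fin n, (-1 : R) ^ ((j : ℕ) + 1) • f (merge j a) +
      (-1 : R) ^ (n + 1) • (f (fun i => a i.castSucc) * a (Fin.last n)) := by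
  simp only [diff, add_apply, sum_apply, smul_apply,
    subst_apply]
  rfl

/-- `merge` on infinite sequences. -/
def mergeSeq (j : ℕ) (a : ℕ → A) : ℕ → A := fun p =>
  if p < j then a p else if p = j then a p * a (p + 1) else a (p + 1)

/-- The `i`-th coface, on infinite sequences. -/
def face {n : ℕ} (f : MultilinearMap R (fun _ : Fin n => A) A) (i : ℕ) (a : ℕ → A) : A :=
  if i = 0 then a 0 * ev f (fun p => a (p + 1))
  else if i = n + 1 then ev f a * a n
  else ev f (mergeSeq (i - 1) a)

theorem ev_diff {n : ℕ} (f : MultilinearMap R (fun _ : Fin n => A) A) (a : ℕ → A) :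
    ev (diff f) a = a 0 * ev f (fun p => a (p + 1)) +
      ∑ j ∈ Finset.range n, (-1 : R) ^ (j + 1) • ev f (mergeSeq j a) +
      (-1 : R) ^ (n + 1) • (ev f a * a n) := by
  have h : ∀ j : Fin n, merge j (fun i => a i) = fun p : Fin n => mergeSeq j a p := by
    intro j
    funext p
    simp only [merge, mergeSeq, Fin.lt_def, Fin.ext_iff, Fin.val_succ, Fin.val_castSucc]
  unfold ev
  rw [diff_apply, Finset.sum_range]
  simp only [h]
  rfl

theorem ev_diff_face {n : ℕ} (f : MultilinearMap R (fun _ : Fin n => A) A) (a : ℕ → A) :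
    ev (diff f) a = ∑ i ∈ Finset.range (n + 2), (-1 : R) ^ i • face f i a := by
  rw [ev_diff, Finset.sum_range_succ, Finset.sum_range_succ']
  have h : ∀ j ∈ Finset.range n, (-1 : R) ^ (j + 1) • face f (j + 1) a =
      (-1 : R) ^ (j + 1) • ev f (mergeSeq j a) := by
    intro j hj
    have : j ≠ n := (Finset.mem_range.1 hj).ne
    simp [face, this]
  rw [Finset.sum_congr rfl h]
  simp only [face, if_true, pow_zero, one_smul, Nat.succ_ne_zero, if_false]
  abel

variable (R A) in
/-- Normalized cochains of degree `n`: the multilinear maps `A ^ n → A` that vanish as soon as one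
of their arguments is `1`. They are the linear maps from the `n`-th tensor power of `A / R·1`
to `A`. -/
def Cochain (n : ℕ) : Submodule R (MultilinearMap R (fun _ : Fin n => A) A) where
  carrier := {f | ∀ (a : Fin n → A) (i : Fin n), a i = 1 → f a = 0}
  add_mem' {f g} hf hg a i h := by simp [hf a i h, hg a i h]
  zero_mem' a i h := rfl
  smul_mem' c f hf a i h := by simp [hf a i h]

theorem mem_Cochain_iff_ev {n : ℕ} (f : MultilinearMap R (fun _ : Fin n => A) A) :
    f ∈ Cochain R A n ↔ ∀ (a : ℕ → A) (i : ℕ), i < n → a i = 1 → ev f a = 0 := by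
  constructor
  · intro h a i hi ha
    exact h _ ⟨i, hi⟩ ha
  · intro h a i ha
    have := h (fun p => if hp : p < n then a ⟨p, hp⟩ else 0) i i.2 (by simpa using ha)
    simpa [ev] using this

theorem diff_mem {n : ℕ} {f : MultilinearMap R (fun _ : Fin n => A) A} (hf : f ∈ Cochain R A n) :
    diff f ∈ Cochain R A (n + 1) := by
  rw [mem_Cochain_iff_ev] at hf ⊢
  intro a q hq ha
  rw [ev_diff_face]
  have h1 : ∀ i ∈ Finset.range (n + 2), i ≠ q → i ≠ q + 1 → face f i a = 0 := by
    intro i hi h h'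
    have hi := Finset.mem_range.1 hi
    unfold face
    split_ifs with h0 hn
    · rw [hf _ (q - 1) (by omega) (by rw [← ha]; congr 1; omega), mul_zero]
    · rw [hf _ q (by omega) ha, zero_mul]
    · by_cases hlt : q < i - 1
      · exact hf _ q (by omega) (by simp [mergeSeq, hlt, ha])
      · refine hf _ (q - 1) (by omega) ?_
        have e1 : ¬ (q - 1 < i - 1) := by omega
        have e2 : ¬ (q - 1 = i - 1) := by omega
        have e3 : q - 1 + 1 = q := by omega
        simp only [mergeSeq, if_neg e1, if_neg e2, e3, ha]
  have h2 : face f q a = face f (q + 1) a := by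
    unfold face
    by_cases h0 : q = 0
    · subst h0
      by_cases hn : n = 0
      · subst hn
        simp only [if_true, ha, one_mul, zero_add, mul_one]
        simp only [Nat.one_ne_zero, if_false]
        exact ev_congr _ (by simp)
      · have : (0 + 1 : ℕ) ≠ n + 1 := by omega
        simp only [if_true, ha, one_mul, if_neg this]
        simp only [Nat.succ_ne_zero, if_false]
        refine ev_congr _ fun i hi => ?_
        unfold mergeSeq
        rcases i with _ | i <;> simp [ha]
    · have hq1 : q ≠ n + 1 := by omega
      have hq2 : q + 1 ≠ 0 := by omega
      simp only [if_neg h0, if_neg hq1, if_neg hq2, Nat.add_sub_cancel]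
      by_cases hn : q = n
      · subst hn
        simp only [if_true, ha, mul_one]
        refine ev_congr _ fun i hi => ?_
        unfold mergeSeq
        split_ifs with h3 h4
        · rfl
        · have : i + 1 = q := by omega
          rw [this, ha, mul_one]
        · omega
      · have : q + 1 ≠ n + 1 := by omega
        simp only [if_neg this]
        refine ev_congr _ fun i hi => ?_
        unfold mergeSeq
        split_ifs with h3 h4 h5 h6 h7 <;> first | omega | rfl | skip
        · have : i + 1 = q := by omega
          rw [this, ha, mul_one]
        · have : i = q := by omega
          rw [this, ha, one_mul]
  rw [← Finset.sum_subset (s₁ := {q, q + 1})]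
  · rw [Finset.sum_pair (by omega), h2, pow_succ]
    simp
  · intro i hi
    simp only [Finset.mem_insert, Finset.mem_singleton] at hi
    exact Finset.mem_range.2 (by omega)
  · intro i hi hi'
    simp only [Finset.mem_insert, Finset.mem_singleton, not_or] at hi'
    rw [h1 i hi hi'.1 hi'.2, smul_zero]

variable (R A) in
/-- The differential as a linear map. -/
def d (n : ℕ) : MultilinearMap R (fun _ : Fin n => A) A →ₗ[R]
    MultilinearMap R (fun _ : Fin (n + 1) => A) A where
  toFun f := diff f
  map_add' f g := by
    ext a
    simp only [diff_apply, add_apply, mul_add, add_mul, smul_add, Finset.sum_add_distrib]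
    abel
  map_smul' c f := by
    ext a
    simp only [diff_apply, smul_apply, mul_smul_comm, smul_mul_assoc, smul_add, Finset.smul_sum,
      smul_comm c, RingHom.id_apply]

variable (R A) in
/-- Normalized cocycles of degree `n`. -/
def Cocycle (n : ℕ) : Submodule R (MultilinearMap R (fun _ : Fin n => A) A) :=
  Cochain R A n ⊓ LinearMap.ker (d R A n)

variable (R A) in
/-- Coboundaries of degree `n`: the differentials of normalized cochains of degree `n - 1`. -/
def Coboundary : (n : ℕ) → Submodule R (MultilinearMap R (fun _ : Fin n => A) A)
  | 0 => ⊥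
  | n + 1 => (Cochain R A n).map (d R A n)

variable (R A) in
/-- The module of normalized cocycles of degree `n`. -/
def Z (n : ℕ) : Type _ := ↥(Cocycle R A n)

instance (n : ℕ) : AddCommGroup (Z R A n) := Submodule.addCommGroup (Cocycle R A n)

instance (n : ℕ) : Module R (Z R A n) := Submodule.module (Cocycle R A n)

variable (R A) in
/-- The coboundaries, as a submodule of the module of cocycles. -/
def B (n : ℕ) : Submodule R (Z R A n) where
  carrier := {f | f.1 ∈ Coboundary R A n}
  add_mem' hf hg := Submodule.add_mem (Coboundary R A n) hf hg
  zero_mem' := Submodule.zero_mem (Coboundary R A n)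
  smul_mem' c _ hf := Submodule.smul_mem _ c hf

variable (R A) in
/-- The Hochschild cohomology `HH^n(A; A)`: cocycles modulo coboundaries, in the normalized
Hochschild complex. -/
abbrev HH (n : ℕ) : Type _ := Z R A n ⧸ B R A n

/-- The cohomology class of a cocycle. -/
def cls {n : ℕ} (f : MultilinearMap R (fun _ : Fin n => A) A) (hf : f ∈ Cocycle R A n) :
    HH R A n := Submodule.Quotient.mk ⟨f, hf⟩

theorem mem_Cocycle {n : ℕ} {f : MultilinearMap R (fun _ : Fin n => A) A} :
    f ∈ Cocycle R A n ↔ f ∈ Cochain R A n ∧ diff f = 0 := Iff.rfl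

theorem exists_cls {n : ℕ} (x : HH R A n) : ∃ f hf, x = cls (n := n) f hf := by
  obtain ⟨f, rfl⟩ := Submodule.Quotient.mk_surjective _ x
  exact ⟨f.1, f.2, rfl⟩

theorem cls_eq_cls {n : ℕ} {f g : MultilinearMap R (fun _ : Fin n => A) A} (hf hg) :
    cls (R := R) (A := A) f hf = cls g hg ↔ f - g ∈ Coboundary R A n :=
  (Submodule.Quotient.eq (B R A n)).trans Iff.rfl

theorem cls_add {n : ℕ} {f g : MultilinearMap R (fun _ : Fin n => A) A} (hf hg) :
    cls (R := R) (A := A) f hf + cls g hg = cls (f + g) (add_mem hf hg) := rfl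

theorem cls_smul {n : ℕ} (c : R) {f : MultilinearMap R (fun _ : Fin n => A) A} (hf) :
    c • cls (R := R) (A := A) f hf = cls (c • f) (Submodule.smul_mem _ c hf) := rfl

theorem cls_zero {n : ℕ} : cls (R := R) (A := A) (n := n) 0 (zero_mem _) = 0 := rfl

theorem mem_Coboundary_of_ev {m n : ℕ} (h : m + 1 = n)
    {f : MultilinearMap R (fun _ : Fin n => A) A} {u : MultilinearMap R (fun _ : Fin m => A) A}
    (hu : u ∈ Cochain R A m) (hfu : ∀ a, ev f a = ev (diff u) a) : f ∈ Coboundary R A n := by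
  subst h
  exact ⟨u, hu, (ev_ext hfu).symm⟩

theorem Coboundary_zero {f : MultilinearMap R (fun _ : Fin 0 => A) A}
    (hf : f ∈ Coboundary R A 0) : f = 0 := hf

theorem exists_of_mem_Coboundary {n : ℕ} {f : MultilinearMap R (fun _ : Fin n => A) A}
    (hf : f ∈ Coboundary R A n) : f = 0 ∨ ∃ (m : ℕ) (_ : m + 1 = n)
      (u : MultilinearMap R (fun _ : Fin m => A) A), u ∈ Cochain R A m ∧
        ∀ a, ev f a = ev (diff u) a := by
  cases n with
  | zero => exact Or.inl hf
  | succ n =>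
    obtain ⟨u, hu, rfl⟩ := hf
    exact Or.inr ⟨n, rfl, u, hu, fun _ => rfl⟩

/-! ### Cup product -/

/-- The cup product of cochains,
`(f ⌣ g)(x_1, …, x_{k+l}) = f(x_1, …, x_k) g(x_{k+1}, …, x_{k+l})`. -/
def cup {k l : ℕ} (f : MultilinearMap R (fun _ : Fin k => A) A)
    (g : MultilinearMap R (fun _ : Fin l => A) A) :
    MultilinearMap R (fun _ : Fin (k + l) => A) A :=
  prodMap f g (Fin.castAdd l) (Fin.natAdd k) (by
    intro i
    refine Fin.addCases (fun p => ?_) (fun p => ?_) i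
    · refine Or.inl ⟨p, fun q => ?_, fun q => ?_⟩
      · simp [Fin.ext_iff]
      · simp only [ne_eq, Fin.ext_iff, Fin.val_natAdd, Fin.val_castAdd]
        omega
    · refine Or.inr ⟨p, fun q => ?_, fun q => ?_⟩
      · simp [Fin.ext_iff]
      · simp only [ne_eq, Fin.ext_iff, Fin.val_natAdd, Fin.val_castAdd]
        omega)

theorem cup_apply {k l : ℕ} (f : MultilinearMap R (fun _ : Fin k => A) A)
    (g : MultilinearMap R (fun _ : Fin l => A) A) (a : Fin (k + l) → A) :
    cup f g a = f (fun i => a (Fin.castAdd l i)) * g (fun i => a (Fin.natAdd k i)) := rfl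

theorem ev_cup {k l : ℕ} (f : MultilinearMap R (fun _ : Fin k => A) A)
    (g : MultilinearMap R (fun _ : Fin l => A) A) (a : ℕ → A) :
    ev (cup f g) a = ev f a * ev g (fun i => a (k + i)) := rfl

theorem cup_mem {k l : ℕ} {f : MultilinearMap R (fun _ : Fin k => A) A}
    {g : MultilinearMap R (fun _ : Fin l => A) A} (hf : f ∈ Cochain R A k)
    (hg : g ∈ Cochain R A l) : cup f g ∈ Cochain R A (k + l) := by
  rw [mem_Cochain_iff_ev] at *
  intro a i hi ha
  rw [ev_cup]
  by_cases h : i < k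
  · rw [hf a i h ha, zero_mul]
  · rw [hg _ (i - k) (by omega) (by rw [← ha]; congr 1; omega), mul_zero]

/-- The differential is a graded derivation for the cup product. -/
theorem ev_diff_cup {k l : ℕ} (f : MultilinearMap R (fun _ : Fin k => A) A)
    (g : MultilinearMap R (fun _ : Fin l => A) A) (a : ℕ → A) :
    ev (diff (cup f g)) a = ev (cup (diff f) g) a + (-1 : R) ^ k • ev (cup f (diff g)) a := by
  have h1 : ∀ j ∈ Finset.range k, (-1 : R) ^ (j + 1) • ev (cup f g) (mergeSeq j a) =
      (-1 : R) ^ (j + 1) • ev f (mergeSeq j a) * ev g (fun i => a (k + 1 + i)) := by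
    intro j hj
    have hj := Finset.mem_range.1 hj
    rw [ev_cup, smul_mul_assoc]
    congr 2
    refine ev_congr _ fun i _ => ?_
    have e1 : ¬ (k + i < j) := by omega
    have e2 : ¬ (k + i = j) := by omega
    simp only [mergeSeq, if_neg e1, if_neg e2]
    congr 1; omega
  have h2 : ∀ j ∈ Finset.range l, (-1 : R) ^ (k + j + 1) • ev (cup f g) (mergeSeq (k + j) a) =
      (-1 : R) ^ k • (ev f a * (-1 : R) ^ (j + 1) • ev g (mergeSeq j (fun i => a (k + i)))) := by
    intro j _
    rw [ev_cup, mul_smul_comm, smul_smul, ← pow_add, add_assoc]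
    congr 2
    · refine ev_congr _ fun i hi => ?_
      have e1 : i < k + j := by omega
      simp only [mergeSeq, if_pos e1]
    · congr 1
      funext i
      simp only [mergeSeq, add_lt_add_iff_left, add_right_inj, add_assoc]
  rw [ev_diff, Finset.sum_range_add, Finset.sum_congr rfl h1, Finset.sum_congr rfl h2,
    ev_cup, ev_cup, ev_cup, ev_cup, ev_diff, ev_diff]
  simp only [add_mul, mul_add, smul_add, Finset.sum_mul, Finset.mul_sum, Finset.smul_sum,
    smul_mul_assoc, mul_smul_comm, smul_smul, mul_assoc, add_zero]
  have e0 : (fun i => a (k + i + 1)) = fun i => a (k + 1 + i) := by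
    funext i; congr 1; omega
  have e3 : (fun i => a (k + (i + 1))) = fun i => a (k + 1 + i) := by
    funext i; congr 1; omega
  have e4 : (-1 : R) ^ (k + 1) = - (-1 : R) ^ k := by rw [pow_succ]; ring
  have e5 : (-1 : R) ^ (k + l + 1) = (-1 : R) ^ k * (-1 : R) ^ (l + 1) := by
    rw [← pow_add, add_assoc]
  simp only [e0, e3, e4, e5, neg_smul]
  abel

theorem ev_zero {n : ℕ} (a : ℕ → A) :
    ev (0 : MultilinearMap R (fun _ : Fin n => A) A) a = 0 := rfl

theorem cup_mem_Cocycle {k l : ℕ} {f : MultilinearMap R (fun _ : Fin k => A) A}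
    {g : MultilinearMap R (fun _ : Fin l => A) A} (hf : f ∈ Cocycle R A k)
    (hg : g ∈ Cocycle R A l) : cup f g ∈ Cocycle R A (k + l) := by
  rw [mem_Cocycle] at *
  refine ⟨cup_mem hf.1 hg.1, ev_ext fun a => ?_⟩
  rw [ev_diff_cup, ev_cup, ev_cup, hf.2, hg.2, ev_zero, ev_zero, ev_zero, zero_mul, mul_zero,
    smul_zero, add_zero]

theorem cup_zero {k l : ℕ} (f : MultilinearMap R (fun _ : Fin k => A) A) :
    cup f (0 : MultilinearMap R (fun _ : Fin l => A) A) = 0 := by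
  ext a; simp [cup_apply]

theorem zero_cup {k l : ℕ} (g : MultilinearMap R (fun _ : Fin l => A) A) :
    cup (0 : MultilinearMap R (fun _ : Fin k => A) A) g = 0 := by
  ext a; simp [cup_apply]

theorem cup_add {k l : ℕ} (f : MultilinearMap R (fun _ : Fin k => A) A)
    (g g' : MultilinearMap R (fun _ : Fin l => A) A) : cup f (g + g') = cup f g + cup f g' := by
  ext a; simp [cup_apply, mul_add]

theorem add_cup {k l : ℕ} (f f' : MultilinearMap R (fun _ : Fin k => A) A)
    (g : MultilinearMap R (fun _ : Fin l => A) A) : cup (f + f') g = cup f g + cup f' g := by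
  ext a; simp [cup_apply, add_mul]

theorem cup_mem_Coboundary_left {k l : ℕ} {f : MultilinearMap R (fun _ : Fin k => A) A}
    {g : MultilinearMap R (fun _ : Fin l => A) A} (hf : f ∈ Coboundary R A k)
    (hg : g ∈ Cocycle R A l) : cup f g ∈ Coboundary R A (k + l) := by
  rcases exists_of_mem_Coboundary hf with rfl | ⟨m, hm, u, hu, h⟩
  · rw [zero_cup]
    exact Submodule.zero_mem _
  · refine mem_Coboundary_of_ev (m := m + l) (by omega) (u := cup u g) (cup_mem hu hg.1)
      fun a => ?_
    rw [ev_diff_cup, ev_cup, ev_cup, ev_cup, h, (mem_Cocycle.1 hg).2, ev_zero, mul_zero, smul_zero,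
      add_zero, ← hm]

theorem cup_mem_Coboundary_right {k l : ℕ} {f : MultilinearMap R (fun _ : Fin k => A) A}
    {g : MultilinearMap R (fun _ : Fin l => A) A} (hf : f ∈ Cocycle R A k)
    (hg : g ∈ Coboundary R A l) : cup f g ∈ Coboundary R A (k + l) := by
  rcases exists_of_mem_Coboundary hg with rfl | ⟨m, hm, u, hu, h⟩
  · rw [cup_zero]
    exact Submodule.zero_mem _
  · refine mem_Coboundary_of_ev (m := k + m) (by omega) (u := (-1 : R) ^ k • cup f u)
      (Submodule.smul_mem _ _ (cup_mem hf.1 hu)) fun a => ?_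
    have e : ev (diff ((-1 : R) ^ k • cup f u)) a = (-1 : R) ^ k • ev (diff (cup f u)) a :=
      congrArg (fun F => ev F a) ((d R A (k + m)).map_smul ((-1 : R) ^ k) (cup f u))
    rw [e, ev_diff_cup, ev_cup, ev_cup, ev_cup, h, (mem_Cocycle.1 hf).2, ev_zero, zero_mul,
      zero_add, smul_smul, ← pow_add, Even.neg_one_pow ⟨k, rfl⟩, one_smul]

/-- The cup product on cohomology. -/
def hmul {k l : ℕ} (x : HH R A k) (y : HH R A l) : HH R A (k + l) :=
  Quotient.map₂ (sa := (B R A k).quotientRel) (sb := (B R A l).quotientRel)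
    (sc := (B R A (k + l)).quotientRel)
    (fun f g => ⟨cup f.1 g.1, cup_mem_Cocycle f.2 g.2⟩) (by
      intro f f' hf g g' hg
      have hf' : f.1 - f'.1 ∈ Coboundary R A k := (Submodule.quotientRel_def (B R A k)).1 hf
      have hg' : g.1 - g'.1 ∈ Coboundary R A l := (Submodule.quotientRel_def (B R A l)).1 hg
      refine (Submodule.quotientRel_def (B R A (k + l))).2 ?_
      change cup f.1 g.1 - cup f'.1 g'.1 ∈ Coboundary R A (k + l)
      have e : cup f.1 g.1 - cup f'.1 g'.1 =
          cup (f.1 - f'.1) g.1 + cup f'.1 (g.1 - g'.1) := by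
        ext a
        simp [cup_apply, sub_mul, mul_sub]
      rw [e]
      exact Submodule.add_mem _ (cup_mem_Coboundary_left hf' g.2)
        (cup_mem_Coboundary_right f'.2 hg')) x y

theorem hmul_cls {k l : ℕ} {f : MultilinearMap R (fun _ : Fin k => A) A}
    {g : MultilinearMap R (fun _ : Fin l => A) A} (hf hg) :
    hmul (R := R) (A := A) (cls f hf) (cls g hg) = cls (cup f g) (cup_mem_Cocycle hf hg) := rfl

/-- The cochain of degree `0` with value `x`. -/
def const (x : A) : MultilinearMap R (fun _ : Fin 0 => A) A :=
  MultilinearMap.constOfIsEmpty R (fun _ : Fin 0 => A) x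

theorem ev_const (x : A) (a : ℕ → A) : ev (const (R := R) x) a = x := rfl

theorem const_mem (r : R) : const (algebraMap R A r) ∈ Cocycle R A 0 := by
  refine mem_Cocycle.2 ⟨fun a i => i.elim0, ev_ext fun a => ?_⟩
  rw [ev_diff, ev_const, ev_const, ev_zero]
  simp [Algebra.commutes r (a 0)]

theorem sigma_cls_eq {m n : ℕ} (h : m = n) {f : MultilinearMap R (fun _ : Fin m => A) A}
    {g : MultilinearMap R (fun _ : Fin n => A) A} (hf hg) (hfg : ∀ a, ev f a = ev g a) :
    (⟨m, cls f hf⟩ : GradedMonoid (HH R A)) = ⟨n, cls g hg⟩ := by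
  subst h
  obtain rfl := ev_ext hfg
  rfl

instance : GradedMonoid.GMul (HH R A) where
  mul := hmul

instance : GradedMonoid.GOne (HH R A) where
  one := cls (const (algebraMap R A 1)) (const_mem 1)

/-- The Hochschild cohomology is a graded ring under the cup product. -/
instance : DirectSum.GRing (HH R A) where
  one_mul := by
    rintro ⟨n, x⟩
    obtain ⟨f, hf, rfl⟩ := exists_cls x
    refine sigma_cls_eq (Nat.zero_add n) (cup_mem_Cocycle (const_mem 1) hf) hf fun a => ?_
    simp [ev_cup, ev_const]
  mul_one := by
    rintro ⟨n, x⟩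
    obtain ⟨f, hf, rfl⟩ := exists_cls x
    refine sigma_cls_eq (Nat.add_zero n) (cup_mem_Cocycle hf (const_mem 1)) hf fun a => ?_
    simp [ev_cup, ev_const]
  mul_assoc := by
    rintro ⟨k, x⟩ ⟨l, y⟩ ⟨m, z⟩
    obtain ⟨f, hf, rfl⟩ := exists_cls x
    obtain ⟨g, hg, rfl⟩ := exists_cls y
    obtain ⟨h, hh, rfl⟩ := exists_cls z
    refine sigma_cls_eq (Nat.add_assoc k l m)
      (cup_mem_Cocycle (cup_mem_Cocycle hf hg) hh)
      (cup_mem_Cocycle hf (cup_mem_Cocycle hg hh)) fun a => ?_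
    simp only [ev_cup, mul_assoc, add_assoc]
  mul_zero := by
    intro i j x
    obtain ⟨f, hf, rfl⟩ := exists_cls x
    refine (cls_eq_cls (cup_mem_Cocycle hf (zero_mem _)) (zero_mem _)).2 ?_
    rw [cup_zero, sub_zero]
    exact Submodule.zero_mem _
  zero_mul := by
    intro i j x
    obtain ⟨f, hf, rfl⟩ := exists_cls x
    refine (cls_eq_cls (cup_mem_Cocycle (zero_mem _) hf) (zero_mem _)).2 ?_
    rw [zero_cup, sub_zero]
    exact Submodule.zero_mem _
  mul_add := by
    intro i j x y z
    obtain ⟨f, hf, rfl⟩ := exists_cls x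
    obtain ⟨g, hg, rfl⟩ := exists_cls y
    obtain ⟨h, hh, rfl⟩ := exists_cls z
    refine (cls_eq_cls (cup_mem_Cocycle hf (add_mem hg hh))
      (add_mem (cup_mem_Cocycle hf hg) (cup_mem_Cocycle hf hh))).2 ?_
    rw [cup_add, sub_self]
    exact Submodule.zero_mem _
  add_mul := by
    intro i j x y z
    obtain ⟨f, hf, rfl⟩ := exists_cls x
    obtain ⟨g, hg, rfl⟩ := exists_cls y
    obtain ⟨h, hh, rfl⟩ := exists_cls z
    refine (cls_eq_cls (cup_mem_Cocycle (add_mem hf hg) hh)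
      (add_mem (cup_mem_Cocycle hf hh) (cup_mem_Cocycle hg hh))).2 ?_
    rw [add_cup, sub_self]
    exact Submodule.zero_mem _
  natCast n := n • cls (const (algebraMap R A 1)) (const_mem 1)
  natCast_zero := zero_nsmul _
  natCast_succ n := succ_nsmul _ _
  intCast n := n • cls (const (algebraMap R A 1)) (const_mem 1)
  intCast_ofNat n := natCast_zsmul _ _
  intCast_negSucc_ofNat n := negSucc_zsmul _ _

instance : DirectSum.GAlgebra R (HH R A) where
  toFun :=
    { toFun := fun r => cls (const (algebraMap R A r)) (const_mem r)
      map_zero' := by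
        refine (cls_eq_cls (const_mem 0) (zero_mem _)).2 ?_
        have : const (R := R) (algebraMap R A 0) = 0 := ev_ext fun a => by simp [ev_const, ev_zero]
        rw [this, sub_zero]
        exact Submodule.zero_mem _
      map_add' := by
        intro r s
        refine (cls_eq_cls (const_mem (r + s)) (add_mem (const_mem r) (const_mem s))).2 ?_
        have : const (R := R) (algebraMap R A (r + s)) =
            const (algebraMap R A r) + const (algebraMap R A s) := by
          ext a; simp [const]
        rw [this, sub_self]
        exact Submodule.zero_mem _ }
  map_one := rfl
  map_mul := by
    intro r s
    refine sigma_cls_eq rfl (const_mem (r * s)) (cup_mem_Cocycle (const_mem r) (const_mem s))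
      fun a => ?_
    simp [ev_cup, ev_const]
  commutes := by
    rintro r ⟨n, x⟩
    obtain ⟨f, hf, rfl⟩ := exists_cls x
    refine sigma_cls_eq (Nat.add_comm 0 n) (cup_mem_Cocycle (const_mem r) hf)
      (cup_mem_Cocycle hf (const_mem r)) fun a => ?_
    simp [ev_cup, ev_const, Algebra.commutes]
  smul_def := by
    rintro r ⟨n, x⟩
    obtain ⟨f, hf, rfl⟩ := exists_cls x
    refine sigma_cls_eq (Nat.zero_add n).symm (Submodule.smul_mem _ r hf)
      (cup_mem_Cocycle (const_mem r) hf) fun a => ?_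
    rw [ev_cup, ev_const]
    simp [ev, Algebra.smul_def]

/-! ### Gerstenhaber bracket -/

/-- The argument vector
`(a_1, …, a_{i-1}, g(a_i, …, a_{i+l-1}), a_{i+l}, …, a_{k+l-1})` (with indices starting at `0`
in the code, and `m = k + l - 1`). -/
def insertVec {k l m : ℕ} (h : m + 1 = k + l) (i : Fin k)
    (g : MultilinearMap R (fun _ : Fin l => A) A) (a : Fin m → A) : Fin k → A := fun p =>
  if hp : (p : ℕ) < i then a ⟨p, by omega⟩
  else if hp' : (p : ℕ) = i then g (fun q => a ⟨i + q, by omega⟩)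
  else a ⟨p + l - 1, by omega⟩

theorem insertVec_update {k l m : ℕ} (h : m + 1 = k + l) (i : Fin k)
    (g : MultilinearMap R (fun _ : Fin l => A) A) (a : Fin m → A) (j : Fin m) :
    ∃ (q : Fin k) (L : A →ₗ[R] A), ∀ x,
      insertVec h i g (Function.update a j x) = Function.update (insertVec h i g a) q (L x) := by
  have key : ∀ x, (∀ q : Fin l, (i : ℕ) + q ≠ j) →
      (fun q : Fin l => Function.update a j x ⟨i + q, by omega⟩) =
        fun q : Fin l => a ⟨i + q, by omega⟩ := by
    intro x hq
    funext q
    simp only [Function.update_apply, Fin.ext_iff, if_neg (hq q)]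
  by_cases h1 : (j : ℕ) < i
  · refine ⟨⟨j, by omega⟩, LinearMap.id, fun x => ?_⟩
    funext p
    simp only [insertVec, key x (by intros; omega)]
    simp only [insertVec, Function.update_apply, Fin.ext_iff, LinearMap.id_apply]
    split_ifs <;> first | omega | rfl
  · by_cases h2 : (j : ℕ) < i + l
    · refine ⟨i, g.toLinearMap (fun q => a ⟨i + q, by omega⟩) ⟨j - i, by omega⟩, fun x => ?_⟩
      have key2 : (fun q : Fin l => Function.update a j x ⟨i + q, by omega⟩) =
          Function.update (fun q : Fin l => a ⟨i + q, by omega⟩) ⟨j - i, by omega⟩ x := by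
        funext q
        simp only [Function.update_apply, Fin.ext_iff]
        split_ifs <;> first | omega | rfl
      funext p
      simp only [insertVec, key2, MultilinearMap.toLinearMap_apply]
      simp only [insertVec, Function.update_apply, Fin.ext_iff]
      split_ifs <;> first | omega | rfl
    · refine ⟨⟨j + 1 - l, by omega⟩, LinearMap.id, fun x => ?_⟩
      funext p
      simp only [insertVec, key x (by intros; omega)]
      simp only [insertVec, Function.update_apply, Fin.ext_iff, LinearMap.id_apply]
      split_ifs <;> first | omega | rfl

/-- The composition `f ∘ g` of cochains of degrees `k` and `l`, of degree `m = k + l - 1`: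
`∑_{i=1}^{k} (-1)^((l-1)(i-1)) f(a_1, …, a_{i-1}, g(a_i, …, a_{i+l-1}), a_{i+l}, …)`. The index `i`
of the code starts at `0`. -/
def circ {k l m : ℕ} (h : m + 1 = k + l) (f : MultilinearMap R (fun _ : Fin k => A) A)
    (g : MultilinearMap R (fun _ : Fin l => A) A) : MultilinearMap R (fun _ : Fin m => A) A :=
  ∑ i : Fin k, (-1 : R) ^ ((l + 1) * (i : ℕ)) •
    subst f (insertVec h i g) (insertVec_update h i g)

/-- The Gerstenhaber bracket of cochains,
`{f, g} = f ∘ g - (-1)^((|f|-1)(|g|-1)) g ∘ f`, of degree `m = k + l - 1`. -/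
def bracket {k l m : ℕ} (h : m + 1 = k + l) (f : MultilinearMap R (fun _ : Fin k => A) A)
    (g : MultilinearMap R (fun _ : Fin l => A) A) : MultilinearMap R (fun _ : Fin m => A) A :=
  circ h f g - (-1 : R) ^ ((k + 1) * (l + 1)) • circ (h.trans (Nat.add_comm k l)) g f

/-! ### The operator of a symmetric algebra -/

variable (R A) in
/-- A Frobenius form making `A` a symmetric algebra: an associative symmetric bilinear form,
together with a basis of `A` and its dual basis (whose existence makes the form nonsingular). -/
structure SymmetricForm (ι : Type*) where
  form : A →ₗ[R] A →ₗ[R] R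
  assoc : ∀ a b c, form (a * b) c = form a (b * c)
  symm : ∀ a b, form a b = form b a
  basis : Module.Basis ι R A
  dual : ι → A
  form_basis_dual : ∀ i, form (basis i) (dual i) = 1
  form_basis_dual_ne : ∀ i j, i ≠ j → form (basis i) (dual j) = 0

/-- With `a_0 = x`, the cyclic rotation `(a_i, …, a_m, a_0, a_1, …, a_{i-1})` of
`(a_0, a_1, …, a_m)`. -/
def rotate {m : ℕ} (i : Fin (m + 1)) (x : A) (a : Fin m → A) : Fin (m + 1) → A := fun p =>
  (Fin.cons x a : Fin (m + 1) → A) (p + i)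

theorem rotate_update {m : ℕ} (i : Fin (m + 1)) (x : A) (a : Fin m → A) (j : Fin m) :
    ∃ (q : Fin (m + 1)) (L : A →ₗ[R] A), ∀ y,
      rotate i x (Function.update a j y) = Function.update (rotate i x a) q (L y) := by
  refine ⟨j.succ - i, LinearMap.id, fun y => ?_⟩
  funext p
  simp only [rotate, Fin.cons_update, Function.update_apply, LinearMap.id_apply, eq_sub_iff_add_eq]

/-- The operator dual to the Connes operator: for a cochain `f` of degree `m + 1`,
`(Δf)(a_1, …, a_m) = ∑_j ∑_{i=0}^{m} (-1)^(im) ⟨1, f(a_i, …, a_m, a^j, a_1, …, a_{i-1})⟩ (a^j)^∨`,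
where `a^j` runs through a basis of `A` and `(a^j)^∨` through the dual basis; the arguments of `f`
are the cyclic rotations of `(a^j, a_1, …, a_m)`. -/
def SymmetricForm.bv {ι : Type*} [Fintype ι] (F : SymmetricForm R A ι) {m : ℕ}
    (f : MultilinearMap R (fun _ : Fin (m + 1) => A) A) :
    MultilinearMap R (fun _ : Fin m => A) A :=
  ∑ j : ι, ∑ i : Fin (m + 1), (-1 : R) ^ ((i : ℕ) * m) •
    ((LinearMap.toSpanSingleton R A (F.dual j)).comp (F.form 1)).compMultilinearMap
      (subst f (rotate i (F.basis j)) (rotate_update i (F.basis j)))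

theorem SymmetricForm.bv_apply {ι : Type*} [Fintype ι] (F : SymmetricForm R A ι) {m : ℕ}
    (f : MultilinearMap R (fun _ : Fin (m + 1) => A) A) (a : Fin m → A) :
    F.bv f a = ∑ j : ι, ∑ i : Fin (m + 1), (-1 : R) ^ ((i : ℕ) * m) •
      F.form 1 (f (rotate i (F.basis j) a)) • F.dual j := by
  simp [SymmetricForm.bv, sum_apply]

end Complex

/-! ## The canonical form of a group ring -/

section GroupRing

variable (R G : Type*) [CommRing R] [Group G]

/-- The coefficient of the identity element. -/
def coeffOne : MonoidAlgebra R G →ₗ[R] R where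
  toFun a := a.coeff 1
  map_add' a b := by simp
  map_smul' c a := by simp

theorem coeffOne_single [DecidableEq G] (g : G) (r : R) :
    coeffOne R G (MonoidAlgebra.single g r) = if g = 1 then r else 0 := by
  change (MonoidAlgebra.single g r).coeff 1 = _
  simp [MonoidAlgebra.coeff_single, Finsupp.single_apply]

/-- The canonical form `⟨a, b⟩ = ε(ab)` on the group ring, where `ε` is the coefficient of the
identity element, so that `⟨g, h⟩` is `1` if `g = h⁻¹` and `0` otherwise. The basis `(g)` has the
dual basis `(g⁻¹)`. -/
def canonicalForm : SymmetricForm R (MonoidAlgebra R G) G where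
  form := (LinearMap.mul R (MonoidAlgebra R G)).compr₂ (coeffOne R G)
  assoc a b c := by simp [mul_assoc]
  symm a b := by
    have h : (LinearMap.mul R (MonoidAlgebra R G)).compr₂ (coeffOne R G) =
        ((LinearMap.mul R (MonoidAlgebra R G)).compr₂ (coeffOne R G)).flip := by
      classical
      refine (MonoidAlgebra.basis G R).ext fun g => (MonoidAlgebra.basis G R).ext fun h => ?_
      simp only [LinearMap.compr₂_apply, LinearMap.flip_apply, LinearMap.mul_apply',
        MonoidAlgebra.basis_apply, MonoidAlgebra.single_mul_single, coeffOne_single, mul_eq_one_comm (a := g)]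
    exact congrArg (fun F => F a b) h
  basis := MonoidAlgebra.basis G R
  dual g := MonoidAlgebra.single g⁻¹ 1
  form_basis_dual g := by
    classical
    simp [MonoidAlgebra.single_mul_single, coeffOne_single]
  form_basis_dual_ne g h hgh := by
    classical
    simp [MonoidAlgebra.single_mul_single, coeffOne_single, mul_inv_eq_one, hgh]

end GroupRing

/-! ## Gerstenhaber and Batalin–Vilkovisky algebras -/

section BV

variable {R : Type*} [CommRing R] {H : ℕ → Type*} [∀ i, AddCommGroup (H i)] [∀ i, Module R (H i)]
  [DirectSum.GRing H] [DirectSum.GAlgebra R H]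

open DirectSum (of)

/-- The bracket `br`, of degree `-1`, makes the graded algebra `⨁ i, H i` into a Gerstenhaber
algebra. The identities are stated for homogeneous elements. -/
structure IsGerstenhaberAlgebra
    (br : (⨁ i, H i) →ₗ[R] (⨁ i, H i) →ₗ[R] ⨁ i, H i) : Prop where
  mul_comm : ∀ {i j : ℕ} (a : H i) (b : H j),
    of H i a * of H j b = (-1 : R) ^ (i * j) • (of H j b * of H i a)
  degree : ∀ {i j k : ℕ} (a : H i) (b : H j), k + 1 = i + j →
    ∃ c : H k, br (of H i a) (of H j b) = of H k c
  degree_zero : ∀ a b : H 0, br (of H 0 a) (of H 0 b) = 0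
  antisymm : ∀ {i j : ℕ} (a : H i) (b : H j),
    br (of H i a) (of H j b) = -((-1 : R) ^ ((i + 1) * (j + 1)) • br (of H j b) (of H i a))
  jacobi : ∀ {i j k : ℕ} (a : H i) (b : H j) (c : H k),
    br (of H i a) (br (of H j b) (of H k c)) =
      br (br (of H i a) (of H j b)) (of H k c) +
        (-1 : R) ^ ((i + 1) * (j + 1)) • br (of H j b) (br (of H i a) (of H k c))
  poisson : ∀ {i j k : ℕ} (a : H i) (b : H j) (c : H k),
    br (of H i a) (of H j b * of H k c) =
      br (of H i a) (of H j b) * of H k c +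
        (-1 : R) ^ ((i + 1) * j) • (of H j b * br (of H i a) (of H k c))

/-- The bracket `br` and the operator `Δ`, of degree `-1`, make the graded algebra `⨁ i, H i` into a Batalin–Vilkovisky algebra. -/
structure IsBVAlgebra (br : (⨁ i, H i) →ₗ[R] (⨁ i, H i) →ₗ[R] ⨁ i, H i)
    (Δ : (⨁ i, H i) →ₗ[R] ⨁ i, H i) : Prop extends IsGerstenhaberAlgebra br where
  delta_degree : ∀ {i : ℕ} (a : H (i + 1)), ∃ c : H i, Δ (of H (i + 1) a) = of H i c
  delta_degree_zero : ∀ a : H 0, Δ (of H 0 a) = 0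
  delta_delta : ∀ x, Δ (Δ x) = 0
  bracket_eq : ∀ {i j : ℕ} (a : H i) (b : H j),
    br (of H i a) (of H j b) =
      -((-1 : R) ^ i • (Δ (of H i a * of H j b) - Δ (of H i a) * of H j b -
        (-1 : R) ^ i • (of H i a * Δ (of H j b))))

end BV

section Induced

variable {R A : Type*} [CommRing R] [Ring A] [Algebra R A]

open DirectSum (of)

/-- `br` is the bracket on `HH^*(A; A)` induced by the Gerstenhaber bracket of cochains. -/
structure IsInducedBracket
    (br : (⨁ i, HH R A i) →ₗ[R] (⨁ i, HH R A i) →ₗ[R] ⨁ i, HH R A i) : Prop where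
  apply_cls : ∀ {k l m : ℕ} (h : m + 1 = k + l) (f : MultilinearMap R (fun _ : Fin k => A) A)
    (g : MultilinearMap R (fun _ : Fin l => A) A) (hf : f ∈ Cocycle R A k) (hg : g ∈ Cocycle R A l),
    ∃ hfg : bracket h f g ∈ Cocycle R A m,
      br (of (HH R A) k (cls f hf)) (of (HH R A) l (cls g hg)) =
        of (HH R A) m (cls (bracket h f g) hfg)
  apply_zero : ∀ x y : HH R A 0, br (of (HH R A) 0 x) (of (HH R A) 0 y) = 0

/-- `Δ` is the operator on `HH^*(A; A)` induced by the operator on cochains that belongs to the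
Frobenius form `F`. -/
structure IsInducedDelta {ι : Type*} [Fintype ι] (F : SymmetricForm R A ι)
    (Δ : (⨁ i, HH R A i) →ₗ[R] ⨁ i, HH R A i) : Prop where
  apply_cls : ∀ {m : ℕ} (f : MultilinearMap R (fun _ : Fin (m + 1) => A) A)
    (hf : f ∈ Cocycle R A (m + 1)),
    ∃ h : F.bv f ∈ Cocycle R A m,
      Δ (of (HH R A) (m + 1) (cls f hf)) = of (HH R A) m (cls (F.bv f) h)
  apply_zero : ∀ x : HH R A 0, Δ (of (HH R A) 0 x) = 0

end Induced

end Hochschild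

end

/-! Everything follows from one periodicity statement. Put `A` for the group algebra. Restricting
multilinear maps to group elements (`onGroup`, `ofGroup`) turns normalized Hochschild cochains into
normalized cochains of the cyclic group with values in `A`. The carry of the addition of exponents
gives a 2-cocycle `carryCochain`, and every cocycle of degree `m + 2` is the cup product of the
carry cocycle with a cocycle of degree `m`, up to a coboundary
(`exists_carry_of_groupDiff_eq_zero`). This is computed by hand for `m = 0` and reaches higher `m`
by dimension shifting.

In degree zero the cohomology is `A`, since `A` is commutative. In degree one it vanishes: a
derivation `f` gives an additive map `g ↦ g⁻¹ f(g)` from a finite group to `A`, and `n` is not a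
zero divisor on `A`. By periodicity all odd cohomology vanishes (`HH_eq_zero_of_odd`) and the even
part is generated over `A` by powers of the carry class `z`, which satisfies `n z = 0` because `n`
times the carry cocycle is a coboundary.

That there are no further relations is shown by a left inverse of the map from the presentation. The
trace `φ ↦ ∑_h φ(…, h, x) (hx)⁻¹` lowers degrees by two, commutes with the differential in positive
degrees, and undoes the cup product with the carry cocycle when `x` is the generator and `n > 1`.
Iterated traces of even coboundaries are multiples of `n`, hence die after multiplication by a
positive power of `z` (`evalClass`).

The bracket and `Δ` have degree `-1`, so a value either has an argument of odd degree or lies in odd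
degree itself; both operations are therefore zero on cohomology. It remains to know that they are
induced from cochains at all: `diff_bracket` shows that the differential is a derivation of the
bracket, and `SymmetricForm.diff_bv` that it anticommutes with `Δ`. The axioms of a
Batalin–Vilkovisky algebra then reduce to commutativity of the cup product. -/

noncomputable section

namespace Hochschild

/-! ### The Gerstenhaber bracket and the differential -/

section Bracket

variable {R A : Type*} [CommRing R] [Ring A] [Algebra R A]

/-- The argument vector of `f ∘ᵢ γ` on infinite sequences, where `γ` has degree `l`. -/
def insSeq (i l : ℕ) (γ : (ℕ → A) → A) (a : ℕ → A) : ℕ → A := fun p =>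
  if p < i then a p else if p = i then γ (fun q => a (i + q)) else a (p + l - 1)

theorem ev_subst_insertVec {k l m : ℕ} (h : m + 1 = k + l) (i : Fin k)
    (f : MultilinearMap R (fun _ : Fin k => A) A)
    (g : MultilinearMap R (fun _ : Fin l => A) A) (a : ℕ → A) :
    ev (subst f (insertVec h i g) (insertVec_update h i g)) a =
      ev f (insSeq i l (ev g) a) := by
  unfold ev
  rfl

theorem ev_add {n : ℕ} (f g : MultilinearMap R (fun _ : Fin n => A) A) (a : ℕ → A) :
    ev (f + g) a = ev f a + ev g a := rfl

theorem ev_sub {n : ℕ} (f g : MultilinearMap R (fun _ : Fin n => A) A) (a : ℕ → A) :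
    ev (f - g) a = ev f a - ev g a := rfl

theorem ev_smul {n : ℕ} (c : R) (f : MultilinearMap R (fun _ : Fin n => A) A) (a : ℕ → A) :
    ev (c • f) a = c • ev f a := rfl

theorem ev_circ {k l m : ℕ} (h : m + 1 = k + l) (f : MultilinearMap R (fun _ : Fin k => A) A)
    (g : MultilinearMap R (fun _ : Fin l => A) A) (a : ℕ → A) :
    ev (circ h f g) a =
      ∑ i ∈ Finset.range k, (-1 : R) ^ ((l + 1) * i) • ev f (insSeq i l (ev g) a) := by
  rw [Finset.sum_range]
  simp only [← ev_subst_insertVec h]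
  unfold ev circ
  simp only [sum_apply, smul_apply]

/-- A multilinear map commutes with linear combinations in the slot filled by `insSeq`. -/
theorem ev_insSeq_sum {k : ℕ} (f : MultilinearMap R (fun _ : Fin k => A) A) {i : ℕ} (hi : i < k)
    (l : ℕ) {ι : Type*} (s : Finset ι) (c : ι → R) (γ : ι → (ℕ → A) → A) (a : ℕ → A) :
    ev f (insSeq i l (fun b => ∑ t ∈ s, c t • γ t b) a) =
      ∑ t ∈ s, c t • ev f (insSeq i l (γ t) a) := by
  have h : ∀ γ : (ℕ → A) → A, ev f (insSeq i l γ a) =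
      f.toLinearMap (fun p : Fin k => insSeq i l (fun _ => 0) a p) ⟨i, hi⟩
        (γ (fun q => a (i + q))) := by
    intro γ
    unfold ev
    rw [MultilinearMap.toLinearMap_apply]
    congr 1
    funext p
    simp only [insSeq, Function.update_apply, Fin.ext_iff]
    split_ifs <;> first | omega | rfl
  simp only [h, map_sum, map_smul]

section Faces

variable {k l m : ℕ} (f : MultilinearMap R (fun _ : Fin k => A) A)
  (g : MultilinearMap R (fun _ : Fin l => A) A) (F : MultilinearMap R (fun _ : Fin m => A) A)
  {i : ℕ} (a : ℕ → A)

/-- These cofaces act on arguments to the left of the block fed to `g`. They use up one argument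
there, so before the coface is taken the block sits one place further right. -/
theorem face_insSeq_left (h : m + 1 = k + l) (hi : i < k)
    (hF : ∀ a, ev F a = ev f (insSeq i l (ev g) a)) {c : ℕ} (hc : c ≤ i) :
    face F c a = face f c (insSeq (i + 1) l (ev g) a) := by
  have hs : (fun q => a (i + q + 1)) = fun q => a (i + 1 + q) := by
    funext q; congr 1; omega
  rcases c with _ | c
  · simp only [face, if_true, hF]
    congr 1
    refine ev_congr _ fun p hp => ?_
    simp only [insSeq, hs, add_lt_add_iff_right, add_left_inj]
    split_ifs <;> first | rfl | (congr 1; omega)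
  · have e1 : c + 1 ≠ m + 1 := by omega
    have e2 : c + 1 ≠ k + 1 := by omega
    simp only [face, Nat.succ_ne_zero, if_false, if_neg e1, if_neg e2, hF, Nat.add_sub_cancel]
    refine ev_congr _ fun p hp => ?_
    have e3 : (fun q => mergeSeq c a (i + q)) = fun q => a (i + 1 + q) := by
      funext q
      have e4 : ¬ (i + q < c) := by omega
      have e5 : ¬ (i + q = c) := by omega
      simp only [mergeSeq, if_neg e4, if_neg e5]
      congr 1; omega
    simp only [insSeq, e3]
    simp only [mergeSeq, insSeq]
    grind

/-- Here both multiplied arguments lie in the block of `g`, so the coface becomes an inner coface of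
`g`. -/
theorem face_insSeq_mid (h : m + 1 = k + l) (hi : i < k)
    (hF : ∀ a, ev F a = ev f (insSeq i l (ev g) a)) {e : ℕ} (he : e < l) :
    face F (i + 1 + e) a = ev f (insSeq i (l + 1) (face g (e + 1)) a) := by
  have e1 : i + 1 + e ≠ m + 1 := by omega
  have e2 : e + 1 ≠ l + 1 := by omega
  have e0 : i + 1 + e ≠ 0 := by omega
  have e3 : i + 1 + e - 1 = i + e := by omega
  simp only [face, if_neg e0, if_neg e1, hF, e3]
  refine ev_congr _ fun p hp => ?_
  simp only [insSeq, face, Nat.succ_ne_zero, if_false, if_neg e2, Nat.add_sub_cancel]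
  have e4 : (fun q => mergeSeq (i + e) a (i + q)) = mergeSeq e fun q => a (i + q) := by
    funext q
    simp only [mergeSeq, add_lt_add_iff_left, add_right_inj, add_assoc]
  simp only [e4]
  unfold mergeSeq
  split_ifs <;> first | rfl | omega | (congr 1; omega)

theorem face_insSeq_right (h : m + 1 = k + l)
    (hF : ∀ a, ev F a = ev f (insSeq i l (ev g) a)) (c : ℕ) :
    face F (i + 1 + l + c) a = face f (i + 2 + c) (insSeq i l (ev g) a) := by
  have e0 : i + 1 + l + c ≠ 0 := by omega
  have e0' : i + 2 + c ≠ 0 := by omega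
  by_cases hk : i + 2 + c = k + 1
  · have e1 : i + 1 + l + c = m + 1 := by omega
    simp only [face, if_neg e0, if_neg e0', if_pos hk, if_pos e1, hF]
    congr 1
    have e2 : ¬ (k < i) := by omega
    have e3 : ¬ (k = i) := by omega
    simp only [insSeq, if_neg e2, if_neg e3]
    congr 1; omega
  · have e1 : i + 1 + l + c ≠ m + 1 := by omega
    simp only [face, if_neg e0, if_neg e0', if_neg hk, if_neg e1, hF]
    refine ev_congr _ fun p hp => ?_
    have e3 : ev g (fun q => mergeSeq (i + 1 + l + c - 1) a (i + q)) =
        ev g (fun q => a (i + q)) := by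
      refine ev_congr _ fun q hq => ?_
      have e4 : i + q < i + 1 + l + c - 1 := by omega
      simp only [mergeSeq, if_pos e4]
    simp only [insSeq, e3]
    simp only [mergeSeq, insSeq]
    grind

/-- The outer cofaces of `g` multiply its value by a neighbouring argument, which is also what an
inner coface of `f` does. Here and in `insSeq_face_last` this identifies the terms that cancel
between `f ∘ dg` and `df ∘ g`. -/
theorem insSeq_face_zero (hi : i < k) :
    ev f (insSeq i (l + 1) (face g 0) a) = face f (i + 1) (insSeq (i + 1) l (ev g) a) := by
  have e1 : i + 1 ≠ k + 1 := by omega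
  simp only [face, Nat.succ_ne_zero, if_false, if_neg e1, Nat.add_sub_cancel]
  refine ev_congr _ fun p hp => ?_
  have e2 : (fun q => a (i + (q + 1))) = fun q => a (i + 1 + q) := by
    funext q; congr 1; omega
  simp only [insSeq, mergeSeq, face, if_true, e2]
  split_ifs <;> first | rfl | omega | (congr 1; omega) | skip
  subst_vars
  rfl

theorem insSeq_face_last (hi : i < k) :
    ev f (insSeq i (l + 1) (face g (l + 1)) a) = face f (i + 1) (insSeq i l (ev g) a) := by
  have e1 : i + 1 ≠ k + 1 := by omega
  simp only [face, Nat.succ_ne_zero, if_false, if_neg e1, Nat.add_sub_cancel]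
  refine ev_congr _ fun p hp => ?_
  have e2 : face g (l + 1) (fun q => a (i + q)) = ev g (fun q => a (i + q)) * a (i + l) := by
    simp [face]
  simp only [insSeq, mergeSeq, e2]
  grind

/-- With its counterpart `face_last_insSeq`, this is the part of `df ∘ g` that nothing cancels: `g`
fills an extreme slot of `df` and an outer coface splits it off, leaving a cup product. -/
theorem face_zero_insSeq :
    face f 0 (insSeq 0 l (ev g) a) = ev g a * ev f (fun q => a (l + q)) := by
  simp only [face, if_true, insSeq, Nat.lt_irrefl, if_false, Nat.not_lt_zero, zero_add,
    Nat.succ_ne_zero]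
  congr 2
  funext q; congr 1; omega

theorem face_last_insSeq :
    face f (k + 1) (insSeq k l (ev g) a) = ev f a * ev g (fun q => a (k + q)) := by
  simp only [face, if_true, insSeq, Nat.lt_irrefl, if_false, Nat.succ_ne_zero]
  congr 1
  refine ev_congr _ fun p hp => ?_
  simp only [insSeq, if_pos hp]

end Faces

theorem neg_one_pow_congr {a b : ℕ} (h : a % 2 = b % 2) : (-1 : R) ^ a = (-1 : R) ^ b := by
  rw [neg_one_pow_eq_pow_mod_two, h, ← neg_one_pow_eq_pow_mod_two]

theorem neg_one_pow_congr_neg {a b : ℕ} (h : a % 2 = (b + 1) % 2) :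
    (-1 : R) ^ a = -(-1 : R) ^ b := by
  rw [neg_one_pow_congr h, pow_succ, mul_neg_one]

/-- The differential of `f ∘ g`. -/
theorem ev_diff_circ {k l m : ℕ} (h : m + 1 = k + l) (h1 : m + 1 + 1 = k + (l + 1))
    (h2 : m + 1 + 1 = k + 1 + l) (f : MultilinearMap R (fun _ : Fin k => A) A)
    (g : MultilinearMap R (fun _ : Fin l => A) A) (a : ℕ → A) :
    ev (diff (circ h f g)) a = ev (circ h1 f (diff g)) a +
      (-1 : R) ^ (l + 1) • ev (circ h2 (diff f) g) a +
      (-1 : R) ^ l • (ev g a * ev f (fun q => a (l + q))) -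
      (-1 : R) ^ (l + k * l) • (ev f a * ev g (fun q => a (k + q))) := by
  -- For each insertion place `i` the `m + 2` cofaces split into those left of the block of `g` (`i
  -- + 1`), inside it (`l`) and right of it (`k - i`).
  have hL : ev (diff (circ h f g)) a = ∑ i ∈ Finset.range k, (
      (∑ c ∈ Finset.range (i + 1), (-1 : R) ^ ((l + 1) * i + c) •
        face f c (insSeq (i + 1) l (ev g) a)) +
      (∑ e ∈ Finset.range l, (-1 : R) ^ ((l + 1) * i + (i + 1 + e)) •
        ev f (insSeq i (l + 1) (face g (e + 1)) a)) +
      (∑ c ∈ Finset.range (k - i), (-1 : R) ^ ((l + 1) * i + (i + 1 + l + c)) •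
        face f (i + 2 + c) (insSeq i l (ev g) a))) := by
    have : diff (circ h f g) = ∑ i : Fin k, (-1 : R) ^ ((l + 1) * (i : ℕ)) •
        diff (subst f (insertVec h i g) (insertVec_update h i g)) := by
      change d R A m _ = ∑ i : Fin k, _ • d R A m _
      simp only [circ, map_sum, map_smul]
    rw [this, Finset.sum_range]
    have e : ∀ φ : Fin k → MultilinearMap R (fun _ : Fin (m + 1) => A) A,
        ev (∑ i, φ i) a = ∑ i, ev (φ i) a := by
      intro φ; simp only [ev, sum_apply]
    rw [e]
    refine Finset.sum_congr rfl fun i _ => ?_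
    have hF := ev_subst_insertVec h i f g
    rw [ev_smul, ev_diff_face, show m + 2 = (i + 1 + l) + (k - i) by omega, Finset.sum_range_add,
      Finset.sum_range_add, smul_add, smul_add, Finset.smul_sum, Finset.smul_sum, Finset.smul_sum]
    congr 1
    · congr 1
      · refine Finset.sum_congr rfl fun c hc => ?_
        have hc := Finset.mem_range.1 hc
        rw [face_insSeq_left f g _ a h i.2 hF (by omega), smul_smul, pow_add]
      · refine Finset.sum_congr rfl fun c hc => ?_
        rw [face_insSeq_mid f g _ a h i.2 hF (Finset.mem_range.1 hc), smul_smul,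
          pow_add _ _ ((i : ℕ) + 1 + c)]
    · refine Finset.sum_congr rfl fun c _ => ?_
      rw [face_insSeq_right f g _ a h hF c, smul_smul,
        pow_add _ _ ((i : ℕ) + 1 + l + c)]
  have hM : ev (circ h1 f (diff g)) a = ∑ i ∈ Finset.range k, (
      (-1 : R) ^ (l * i) • face f (i + 1) (insSeq (i + 1) l (ev g) a) +
      (∑ e ∈ Finset.range l, (-1 : R) ^ ((l + 1) * i + (i + 1 + e)) •
        ev f (insSeq i (l + 1) (face g (e + 1)) a)) +
      (-1 : R) ^ (l * i + l + 1) • face f (i + 1) (insSeq i l (ev g) a)) := by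
    rw [ev_circ]
    refine Finset.sum_congr rfl fun i hi => ?_
    have hi := Finset.mem_range.1 hi
    have : ev (diff g) = fun b => ∑ e ∈ Finset.range (l + 2), (-1 : R) ^ e • face g e b := by
      funext b; exact ev_diff_face g b
    rw [this, ev_insSeq_sum f hi, Finset.sum_range_succ, Finset.sum_range_succ',
      insSeq_face_zero f g a hi, insSeq_face_last f g a hi, smul_add, smul_add, Finset.smul_sum]
    rw [add_comm (Finset.sum _ _)]
    congr 1
    · congr 1
      · rw [smul_smul, ← pow_add]
        congr 1
        exact neg_one_pow_congr (by ring_nf; omega)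
      · refine Finset.sum_congr rfl fun e _ => ?_
        rw [smul_smul, ← pow_add]
        congr 1
        exact neg_one_pow_congr (by ring_nf)
    · rw [smul_smul, ← pow_add]
      congr 1
      exact neg_one_pow_congr (by ring_nf; omega)
  -- The cofaces `i` and `i + 1` of `f` involve the value of `g` inserted at `i`, and are isolated.
  -- The sums over cofaces below `i`, and over coface `i` itself, are reindexed by `i ↦ i + 1` to
  -- match `hL` and `hM`; the two extreme terms that drop out are the cup products.
  have hR : ev (circ h2 (diff f) g) a =
      (∑ i ∈ Finset.range k, ∑ c ∈ Finset.range (i + 1), (-1 : R) ^ ((l + 1) * (i + 1) + c) •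
        face f c (insSeq (i + 1) l (ev g) a)) +
      (∑ i ∈ Finset.range k, (-1 : R) ^ ((l + 1) * (i + 1) + (i + 1)) •
        face f (i + 1) (insSeq (i + 1) l (ev g) a)) +
      (∑ i ∈ Finset.range k, (-1 : R) ^ ((l + 1) * i + (i + 1)) •
        face f (i + 1) (insSeq i l (ev g) a)) +
      (∑ i ∈ Finset.range k, ∑ c ∈ Finset.range (k - i), (-1 : R) ^ ((l + 1) * i + (i + 2 + c)) •
        face f (i + 2 + c) (insSeq i l (ev g) a)) +
      ev g a * ev f (fun q => a (l + q)) +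
      (-1 : R) ^ ((l + 1) * k + (k + 1)) • (ev f a * ev g (fun q => a (k + q))) := by
    have e : ev (circ h2 (diff f) g) a = ∑ i ∈ Finset.range (k + 1), (
        (∑ c ∈ Finset.range i, (-1 : R) ^ ((l + 1) * i + c) •
          face f c (insSeq i l (ev g) a)) +
        (-1 : R) ^ ((l + 1) * i + i) • face f i (insSeq i l (ev g) a) +
        (-1 : R) ^ ((l + 1) * i + (i + 1)) • face f (i + 1) (insSeq i l (ev g) a) +
        (∑ c ∈ Finset.range (k - i), (-1 : R) ^ ((l + 1) * i + (i + 2 + c)) •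
          face f (i + 2 + c) (insSeq i l (ev g) a))) := by
      rw [ev_circ]
      refine Finset.sum_congr rfl fun i hi => ?_
      have hi := Finset.mem_range.1 hi
      rw [ev_diff_face, show k + 2 = i + 2 + (k - i) by omega, Finset.sum_range_add,
        Finset.sum_range_succ, Finset.sum_range_succ]
      simp only [smul_add, Finset.smul_sum, smul_smul, pow_add]
    rw [e]
    simp only [Finset.sum_add_distrib]
    rw [Finset.sum_range_succ' (fun i => ∑ c ∈ Finset.range i, _),
      Finset.sum_range_succ' (fun i => (-1 : R) ^ ((l + 1) * i + i) • _),
      Finset.sum_range_succ (fun i => (-1 : R) ^ ((l + 1) * i + (i + 1)) • _),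
      Finset.sum_range_succ (fun i => ∑ c ∈ Finset.range (k - i), _),
      face_zero_insSeq, face_last_insSeq]
    simp only [Nat.sub_self, Finset.range_zero, Finset.sum_empty, add_zero, mul_zero, pow_zero,
      one_smul]
    abel
  rw [hL, hM, hR]
  simp only [Finset.sum_add_distrib, smul_add, Finset.smul_sum, smul_smul, ← pow_add]
  have s1 : ∀ i c : ℕ, (-1 : R) ^ (l + 1 + ((l + 1) * (i + 1) + c)) =
      (-1 : R) ^ ((l + 1) * i + c) := fun i c => neg_one_pow_congr (by ring_nf; omega)
  have s2 : ∀ i : ℕ, (-1 : R) ^ (l + 1 + ((l + 1) * (i + 1) + (i + 1))) =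
      -(-1 : R) ^ (l * i) := fun i => neg_one_pow_congr_neg (by ring_nf; omega)
  have s3 : ∀ i : ℕ, (-1 : R) ^ (l + 1 + ((l + 1) * i + (i + 1))) =
      -(-1 : R) ^ (l * i + l + 1) := fun i => neg_one_pow_congr_neg (by ring_nf; omega)
  have s4 : ∀ i c : ℕ, (-1 : R) ^ (l + 1 + ((l + 1) * i + (i + 2 + c))) =
      (-1 : R) ^ ((l + 1) * i + (i + 1 + l + c)) := fun i c => neg_one_pow_congr (by ring_nf; omega)
  have s5 : (-1 : R) ^ (l + 1 + ((l + 1) * k + (k + 1))) = (-1 : R) ^ (l + k * l) :=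
    neg_one_pow_congr (by ring_nf; omega)
  have s6 : (-1 : R) ^ (l + 1) = -(-1 : R) ^ l := by rw [pow_succ, mul_neg_one]
  simp only [s5]
  simp only [s2, s3]
  simp only [s1, s4, s6, neg_smul, Finset.sum_neg_distrib]
  abel

theorem circ_mem {k l m : ℕ} (h : m + 1 = k + l) {f : MultilinearMap R (fun _ : Fin k => A) A}
    {g : MultilinearMap R (fun _ : Fin l => A) A} (hf : f ∈ Cochain R A k)
    (hg : g ∈ Cochain R A l) : circ h f g ∈ Cochain R A m := by
  rw [mem_Cochain_iff_ev] at *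
  intro a q hq ha
  rw [ev_circ]
  refine Finset.sum_eq_zero fun i hi => ?_
  have hi := Finset.mem_range.1 hi
  have h0 : ∀ b : ℕ → A, b i = 0 → ev f b = 0 := fun b hb =>
    f.map_coord_zero ⟨i, hi⟩ hb
  by_cases h1 : q < i
  · rw [hf _ q (by omega) (by simp [insSeq, h1, ha]), smul_zero]
  · by_cases h2 : q < i + l
    · rw [h0 _ ?_, smul_zero]
      simp only [insSeq, Nat.lt_irrefl, if_false, if_true]
      exact hg _ (q - i) (by omega) (by rw [← ha]; congr 1; omega)
    · rw [hf _ (q + 1 - l) (by omega) ?_, smul_zero]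
      have e1 : ¬ (q + 1 - l < i) := by omega
      have e2 : ¬ (q + 1 - l = i) := by omega
      simp only [insSeq, if_neg e1, if_neg e2]
      rw [← ha]; congr 1; omega

theorem circ_zero {k l m : ℕ} (h : m + 1 = k + l) (f : MultilinearMap R (fun _ : Fin k => A) A) :
    circ h f (0 : MultilinearMap R (fun _ : Fin l => A) A) = 0 := by
  refine ev_ext fun a => ?_
  rw [ev_circ, ev_zero]
  refine Finset.sum_eq_zero fun i hi => ?_
  have : ev f (insSeq i l (ev (0 : MultilinearMap R (fun _ : Fin l => A) A)) a) = 0 :=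
    f.map_coord_zero ⟨i, Finset.mem_range.1 hi⟩ (by simp [insSeq, ev_zero])
  rw [this, smul_zero]

theorem zero_circ {k l m : ℕ} (h : m + 1 = k + l) (g : MultilinearMap R (fun _ : Fin l => A) A) :
    circ h (0 : MultilinearMap R (fun _ : Fin k => A) A) g = 0 := by
  refine ev_ext fun a => ?_
  rw [ev_circ, ev_zero]
  exact Finset.sum_eq_zero fun i _ => by rw [ev_zero, smul_zero]

theorem bracket_mem {k l m : ℕ} (h : m + 1 = k + l) {f : MultilinearMap R (fun _ : Fin k => A) A}
    {g : MultilinearMap R (fun _ : Fin l => A) A} (hf : f ∈ Cochain R A k)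
    (hg : g ∈ Cochain R A l) : bracket h f g ∈ Cochain R A m :=
  Submodule.sub_mem _ (circ_mem h hf hg) (Submodule.smul_mem _ _ (circ_mem _ hg hf))

/-- The cup products `g ⌣ f` and `f ⌣ g`, the defect of `∘` in `ev_diff_circ`, occur in both halves
of the bracket with signs that cancel (`s3`, `s4`). -/
theorem diff_bracket {k l m : ℕ} (h : m + 1 = k + l) (h1 : m + 1 + 1 = k + (l + 1))
    (h2 : m + 1 + 1 = k + 1 + l) (f : MultilinearMap R (fun _ : Fin k => A) A)
    (g : MultilinearMap R (fun _ : Fin l => A) A) :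
    diff (bracket h f g) = bracket h1 f (diff g) +
      (-1 : R) ^ (l + 1) • bracket h2 (diff f) g := by
  refine ev_ext fun a => ?_
  have e : diff (bracket h f g) = diff (circ h f g) - (-1 : R) ^ ((k + 1) * (l + 1)) •
      diff (circ (h.trans (Nat.add_comm k l)) g f) := by
    change d R A m _ = d R A m _ - _ • d R A m _
    rw [bracket, map_sub, map_smul]
  rw [e, ev_sub, ev_smul, ev_diff_circ h h1 h2,
    ev_diff_circ (h.trans (Nat.add_comm k l)) (h2.trans (Nat.add_comm _ _))
      (h1.trans (Nat.add_comm _ _))]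
  simp only [bracket, ev_add, ev_smul, ev_sub, smul_add, smul_sub, smul_smul, ← pow_add]
  have s1 : (-1 : R) ^ ((k + 1) * (l + 1) + (k + 1)) = (-1 : R) ^ ((k + 1) * (l + 1 + 1)) := by
    congr 1
  have s2 : (-1 : R) ^ (l + 1 + (k + 1 + 1) * (l + 1)) = (-1 : R) ^ ((k + 1) * (l + 1)) :=
    neg_one_pow_congr (by ring_nf; omega)
  have s3 : (-1 : R) ^ ((k + 1) * (l + 1) + k) = -(-1 : R) ^ (l + k * l) :=
    neg_one_pow_congr_neg (by ring_nf; omega)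
  have s4 : (-1 : R) ^ ((k + 1) * (l + 1) + (k + l * k)) = -(-1 : R) ^ l :=
    neg_one_pow_congr_neg (by ring_nf; omega)
  simp only [s1, s2, s3, s4, neg_smul]
  abel

theorem bracket_mem_Cocycle {k l m : ℕ} (h : m + 1 = k + l)
    {f : MultilinearMap R (fun _ : Fin k => A) A} {g : MultilinearMap R (fun _ : Fin l => A) A}
    (hf : f ∈ Cocycle R A k) (hg : g ∈ Cocycle R A l) : bracket h f g ∈ Cocycle R A m := by
  refine mem_Cocycle.2 ⟨bracket_mem h hf.1 hg.1, ?_⟩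
  rw [diff_bracket h (by omega) (by omega), (mem_Cocycle.1 hf).2, (mem_Cocycle.1 hg).2]
  simp only [bracket, circ_zero, zero_circ, smul_zero, sub_zero, add_zero]

theorem bracket_antisymm {k l m : ℕ} (h : m + 1 = k + l) (h' : m + 1 = l + k)
    (f : MultilinearMap R (fun _ : Fin k => A) A) (g : MultilinearMap R (fun _ : Fin l => A) A) :
    bracket h f g = -(-1 : R) ^ ((k + 1) * (l + 1)) • bracket h' g f := by
  simp only [bracket, smul_sub, smul_smul, mul_comm (l + 1) (k + 1), neg_smul, neg_mul, ← pow_add,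
    Even.neg_one_pow ⟨(k + 1) * (l + 1), rfl⟩, one_smul]
  abel

theorem bracket_zero_left {k l m : ℕ} (h : m + 1 = k + l)
    (g : MultilinearMap R (fun _ : Fin l => A) A) :
    bracket h (0 : MultilinearMap R (fun _ : Fin k => A) A) g = 0 := by
  simp [bracket, circ_zero, zero_circ]

end Bracket

/-! ### The bracket on cohomology, for commutative algebras -/

section BracketComm

variable {R A : Type*} [CommRing R] [CommRing A] [Algebra R A]

theorem diff_eq_zero_of_comm (f : MultilinearMap R (fun _ : Fin 0 => A) A) : diff f = 0 := by
  refine ev_ext fun a => ?_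
  rw [ev_diff, ev_zero, ev_congr f (b := a) (by simp)]
  simp [mul_comm]

/-- If `dg = 0` then `{du, g} = ± d{u, g}`. The exception is `u` and `g` both of degree zero, where
`{u, g}` would have degree `-1`; there `du` is a commutator and vanishes. -/
theorem bracket_mem_Coboundary_left {k l m : ℕ} (h : m + 1 = k + l)
    {f : MultilinearMap R (fun _ : Fin k => A) A} {g : MultilinearMap R (fun _ : Fin l => A) A}
    (hf : f ∈ Coboundary R A k) (hg : g ∈ Cocycle R A l) :
    bracket h f g ∈ Coboundary R A m := by
  cases k with
  | zero => rw [Coboundary_zero hf, bracket_zero_left]; exact Submodule.zero_mem _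
  | succ k =>
    obtain ⟨u, hu, rfl⟩ := hf
    change bracket h (diff u) g ∈ _
    cases m with
    | zero =>
      obtain rfl : k = 0 := by omega
      rw [diff_eq_zero_of_comm, bracket_zero_left]
      exact Submodule.zero_mem _
    | succ m =>
      refine ⟨(-1 : R) ^ (l + 1) • bracket (m := m) (by omega) u g,
        Submodule.smul_mem _ _ (bracket_mem _ hu hg.1), ?_⟩
      rw [map_smul]
      change _ • diff _ = _
      rw [diff_bracket _ (by omega) h, (mem_Cocycle.1 hg).2, smul_add, smul_smul, ← pow_add,
        Even.neg_one_pow ⟨l + 1, rfl⟩, one_smul]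
      simp only [bracket, circ_zero, zero_circ, smul_zero, sub_zero, zero_add]

theorem bracket_mem_Coboundary_right {k l m : ℕ} (h : m + 1 = k + l)
    {f : MultilinearMap R (fun _ : Fin k => A) A} {g : MultilinearMap R (fun _ : Fin l => A) A}
    (hf : f ∈ Cocycle R A k) (hg : g ∈ Coboundary R A l) :
    bracket h f g ∈ Coboundary R A m := by
  rw [bracket_antisymm h (h.trans (Nat.add_comm _ _))]
  exact Submodule.smul_mem _ _ (bracket_mem_Coboundary_left _ hg hf)

end BracketComm

/-! ### The operator of a symmetric algebra and the differential -/

section BVChain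

variable {R A : Type*} [CommRing R] [Ring A] [Algebra R A]

/-- The rotation by `i` places of the first `N` entries of a sequence. -/
def rotSeq {X : Type*} (N i : ℕ) (y : ℕ → X) : ℕ → X := fun q =>
  if q + i < N then y (q + i) else y (q + i - N)

/-- Multiplication of the cyclically adjacent entries `y_j`, `y_{j+1}` of `(y_0, …, y_{N})`. -/
def cycMerge (N j : ℕ) (y : ℕ → A) : ℕ → A := fun q =>
  if j = N then if q = 0 then y N * y 0 else y q else mergeSeq j y q

/-- The sequence `(x, a_0, a_1, …)`. -/
def consSeq {X : Type*} (x : X) (a : ℕ → X) : ℕ → X := fun q => if q = 0 then x else a (q - 1)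

theorem rotate_eq_rotSeq {X : Type*} {m : ℕ} (i : Fin (m + 1)) (x : X) (a : ℕ → X) :
    rotate i x (fun p : Fin m => a p) =
      fun q : Fin (m + 1) => rotSeq (m + 1) i (consSeq x a) q := by
  have hc : ∀ q : Fin (m + 1), (Fin.cons x (fun p : Fin m => a p) : Fin (m + 1) → X) q =
      consSeq x a q := by
    intro q
    refine Fin.cases ?_ (fun p => ?_) q
    · simp [consSeq]
    · simp [consSeq]
  funext q
  rw [rotate, hc, rotSeq, Fin.val_add]
  split_ifs with h
  · rw [Nat.mod_eq_of_lt h]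
  · congr 1
    rw [Nat.mod_eq_sub_mod (by omega), Nat.mod_eq_of_lt (by omega)]

namespace SymmetricForm

theorem form_one_mul_comm {ι : Type*} (F : SymmetricForm R A ι) (x y : A) :
    F.form 1 (x * y) = F.form 1 (y * x) := by
  rw [← F.assoc, ← F.assoc, one_mul, one_mul, F.symm]

variable {ι : Type*} [Fintype ι] (F : SymmetricForm R A ι)

theorem sum_form_dual (b : A) : ∑ j, F.form b (F.dual j) • F.basis j = b := by
  classical
  conv_rhs => rw [← F.basis.sum_repr b]
  refine Finset.sum_congr rfl fun j _ => ?_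
  congr 1
  conv_lhs => rw [← F.basis.sum_repr b]
  rw [map_sum, LinearMap.sum_apply, Finset.sum_eq_single j]
  · simp [F.form_basis_dual]
  · intro i _ hi
    simp [F.form_basis_dual_ne i j hi]
  · simp

/-- Nondegeneracy lets identities for `F.bv` be tested against an extra element `b`, which then
plays the role of the argument `a_0` of a cyclic word. -/
theorem ext_form {x y : A} (h : ∀ b, F.form b x = F.form b y) : x = y := by
  rw [← F.sum_form_dual x, ← F.sum_form_dual y]
  simp only [F.symm x, F.symm y, h]

/-- The pairing of the value of `F.bv f` with an element of `A`. -/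
theorem form_bv {m : ℕ} (f : MultilinearMap R (fun _ : Fin (m + 1) => A) A) (b : A) (a : ℕ → A) :
    F.form b (ev (F.bv f) a) = ∑ i ∈ Finset.range (m + 1), (-1 : R) ^ (i * m) *
      F.form 1 (ev f (rotSeq (m + 1) i (consSeq b a))) := by
  -- Each rotated value is linear in the rotated-in entry, so the sum over the basis and its dual
  -- collapses to the single entry `b`.
  have hlin : ∀ i : Fin (m + 1), ∃ T : A →ₗ[R] A, ∀ x, T x = f (rotate i x fun p => a p) := by
    intro i
    refine ⟨f.toLinearMap (rotate i 0 fun p => a p) (0 - i), fun x => ?_⟩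
    rw [MultilinearMap.toLinearMap_apply]
    congr 1
    funext q
    simp only [rotate, Function.update_apply]
    split_ifs with h
    · rw [h, sub_add_cancel, Fin.cons_zero]
    · have h' : q + i ≠ 0 := fun h0 => h (by rw [zero_sub]; exact eq_neg_of_add_eq_zero_left h0)
      obtain ⟨p, hp⟩ := Fin.exists_succ_eq_of_ne_zero h'
      rw [← hp, Fin.cons_succ, Fin.cons_succ]
  choose T hT using hlin
  unfold ev
  rw [F.bv_apply, Finset.sum_comm, map_sum, Finset.sum_range]
  refine Finset.sum_congr rfl fun i _ => ?_
  rw [← rotate_eq_rotSeq, ← hT, map_sum]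
  conv_rhs => rw [← F.sum_form_dual b]
  rw [map_sum, map_sum, Finset.mul_sum]
  refine Finset.sum_congr rfl fun j _ => ?_
  simp only [map_smul, smul_eq_mul]
  simp only [hT]
  ring

end SymmetricForm

/-- Multiplying neighbours of a rotated word is rotating a word whose cyclic neighbours were
multiplied. The pair lies before the seam, straddles it (the product `y_{m+1} y_0`, stored in
position `0`), or lies past it; in the last case the shorter word needs one rotation less. -/
theorem rotSeq_cycMerge {m i p : ℕ} (hi : i < m + 2) (hp : p < m + 1) (y : ℕ → A) {j r : ℕ}
    (hjr : i + p < m + 1 ∧ j = i + p ∧ r = i ∨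
      i + p = m + 1 ∧ j = m + 1 ∧ (r = i ∧ i < m + 1 ∨ r = 0 ∧ i = m + 1) ∨
      m + 1 < i + p ∧ j = i + p - (m + 2) ∧ r = i - 1) {q : ℕ} (hq : q < m + 1) :
    mergeSeq p (rotSeq (m + 2) i y) q = rotSeq (m + 1) r (cycMerge (m + 1) j y) q := by
  simp only [mergeSeq, rotSeq, cycMerge]
  rcases hjr with ⟨h, rfl, rfl⟩ | ⟨h, rfl, ⟨rfl, h'⟩ | ⟨rfl, rfl⟩⟩ | ⟨h, rfl, rfl⟩
  · grind
  · grind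
  · grind
  · grind

namespace SymmetricForm

variable {ι : Type*}

/-- The correspondence of `rotSeq_cycMerge` between pairs (rotation, place of the product) and pairs
(cyclic product, rotation) is a bijection, and it reverses every sign. -/
theorem sum_faces_bv (F : SymmetricForm R A ι) {m : ℕ} (f : MultilinearMap R (fun _ : Fin (m + 1) => A) A) (y : ℕ → A) :
    ∑ i ∈ Finset.range (m + 2), ∑ p ∈ Finset.range (m + 1), (-1 : R) ^ (i * (m + 1) + (p + 1)) *
      F.form 1 (ev f (mergeSeq p (rotSeq (m + 2) i y))) =
    -∑ j ∈ Finset.range (m + 2), ∑ r ∈ Finset.range (m + 1), (-1 : R) ^ (j + r * m) *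
      F.form 1 (ev f (rotSeq (m + 1) r (cycMerge (m + 1) j y))) := by
  rw [← Finset.sum_product', ← Finset.sum_product', ← Finset.sum_neg_distrib]
  refine Finset.sum_nbij'
    (fun t => if t.1 + t.2 < m + 1 then (t.1 + t.2, t.1) else if t.1 + t.2 = m + 1 then
      (m + 1, if t.1 = m + 1 then 0 else t.1) else (t.1 + t.2 - (m + 2), t.1 - 1))
    (fun t => if t.1 = m + 1 then if t.2 = 0 then (m + 1, 0) else (t.2, m + 1 - t.2)
      else if t.2 ≤ t.1 then (t.2, t.1 - t.2) else (t.2 + 1, t.1 + m + 1 - t.2)) ?_ ?_ ?_ ?_ ?_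
  · rintro ⟨i, p⟩ h
    simp only [Finset.mem_product, Finset.mem_range] at h ⊢
    grind
  · rintro ⟨j, r⟩ h
    simp only [Finset.mem_product, Finset.mem_range] at h ⊢
    grind
  · rintro ⟨i, p⟩ h
    simp only [Finset.mem_product, Finset.mem_range] at h ⊢
    grind
  · rintro ⟨j, r⟩ h
    simp only [Finset.mem_product, Finset.mem_range] at h ⊢
    grind
  · rintro ⟨i, p⟩ h
    simp only [Finset.mem_product, Finset.mem_range] at h
    obtain ⟨hi, hp⟩ := h
    have key : ∀ j r : ℕ, (i + p < m + 1 ∧ j = i + p ∧ r = i ∨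
        i + p = m + 1 ∧ j = m + 1 ∧ (r = i ∧ i < m + 1 ∨ r = 0 ∧ i = m + 1) ∨
        m + 1 < i + p ∧ j = i + p - (m + 2) ∧ r = i - 1) →
        (i * (m + 1) + (p + 1)) % 2 = (j + r * m + 1) % 2 →
        (-1 : R) ^ (i * (m + 1) + (p + 1)) *
          F.form 1 (ev f (mergeSeq p (rotSeq (m + 2) i y))) =
        -((-1 : R) ^ (j + r * m) *
          F.form 1 (ev f (rotSeq (m + 1) r (cycMerge (m + 1) j y)))) := by
      intro j r hjr hs
      rw [neg_one_pow_congr_neg hs, neg_mul,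
        ev_congr f fun q hq => rotSeq_cycMerge hi hp y hjr hq]
    by_cases h1 : i + p < m + 1
    · simp only [if_pos h1]
      exact key _ _ (Or.inl ⟨h1, rfl, rfl⟩) (by ring_nf)
    · by_cases h2 : i + p = m + 1
      · simp only [if_neg h1, if_pos h2]
        by_cases h3 : i = m + 1
        · simp only [if_pos h3]
          refine key _ _ (Or.inr (Or.inl ⟨h2, rfl, Or.inr ⟨rfl, h3⟩⟩)) ?_
          obtain rfl : p = 0 := by omega
          subst h3
          -- For `i = m + 1` the sign is quadratic in `m`, beyond linear arithmetic until the parity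
          -- of `m (m + 1)` is supplied.
          have : Even (m * (m + 1)) := Nat.even_mul_succ_self m
          obtain ⟨c, hc⟩ := this
          have : (m + 1) * (m + 1) = m * (m + 1) + (m + 1) := by ring
          omega
        · simp only [if_neg h3]
          refine key _ _ (Or.inr (Or.inl ⟨h2, rfl, Or.inl ⟨rfl, by omega⟩⟩)) ?_
          have : i * (m + 1) = i * m + i := by ring
          omega
      · simp only [if_neg h1, if_neg h2]
        refine key _ _ (Or.inr (Or.inr ⟨by omega, rfl, rfl⟩)) ?_
        obtain ⟨i, rfl⟩ : ∃ i', i = i' + 1 := ⟨i - 1, by omega⟩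
        have : (i + 1) * (m + 1) = i * m + i + m + 1 := by ring
        simp only [Nat.add_sub_cancel]
        omega

variable [Fintype ι] (F : SymmetricForm R A ι)

/-- The operator anticommutes with the differential. -/
theorem diff_bv {m : ℕ} (f : MultilinearMap R (fun _ : Fin (m + 1) => A) A) :
    diff (F.bv f) = -F.bv (diff f) := by
  refine ev_ext fun a => F.ext_form fun b => ?_
  have hneg : ev (-F.bv (diff f)) a = -ev (F.bv (diff f)) a := rfl
  rw [hneg, map_neg, F.form_bv]
  set y := consSeq b a with hy
  -- Separates the inner cofaces of each rotation from the two outer ones; the trace property of the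
  -- form moves the last factor to the front.
  have hE : ∀ i ∈ Finset.range (m + 2), (-1 : R) ^ (i * (m + 1)) *
      F.form 1 (ev (diff f) (rotSeq (m + 2) i y)) =
      (∑ p ∈ Finset.range (m + 1), (-1 : R) ^ (i * (m + 1) + (p + 1)) *
        F.form 1 (ev f (mergeSeq p (rotSeq (m + 2) i y)))) +
      ((-1 : R) ^ (i * (m + 1)) * F.form 1 (y i * ev f (fun q => rotSeq (m + 2) i y (q + 1))) -
        (-1 : R) ^ ((i + 1) * (m + 1)) * F.form 1 (rotSeq (m + 2) i y (m + 1) *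
          ev f (rotSeq (m + 2) i y))) := by
    intro i hi
    have hi := Finset.mem_range.1 hi
    have h0 : rotSeq (m + 2) i y 0 = y i := by simp [rotSeq, hi]
    rw [ev_diff, map_add, map_add, map_sum, map_smul, h0, F.form_one_mul_comm (ev f _)]
    have hs : (-1 : R) ^ (i * (m + 1)) * (-1 : R) ^ (m + 1 + 1) =
        -(-1 : R) ^ ((i + 1) * (m + 1)) := by
      rw [← pow_add]; exact neg_one_pow_congr_neg (by ring_nf)
    generalize (-1 : R) ^ ((i + 1) * (m + 1)) = s at hs ⊢
    generalize i * (m + 1) = e at hs ⊢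
    simp only [map_smul, smul_eq_mul, mul_add, Finset.mul_sum, ← mul_assoc, ← pow_add]
    rw [pow_add _ e (m + 1 + 1), hs]
    ring
  -- The outer cofaces cancel cyclically: the last coface of rotation `i + 1` is the first coface of
  -- rotation `i`, and that of rotation `0` is the first coface of rotation `m + 1`.
  have hcan : ∑ i ∈ Finset.range (m + 2), ((-1 : R) ^ (i * (m + 1)) *
        F.form 1 (y i * ev f (fun q => rotSeq (m + 2) i y (q + 1))) -
      (-1 : R) ^ ((i + 1) * (m + 1)) * F.form 1 (rotSeq (m + 2) i y (m + 1) *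
          ev f (rotSeq (m + 2) i y))) = 0 := by
    set E : ℕ → R := fun i => F.form 1 (y i * ev f (fun q => rotSeq (m + 2) i y (q + 1))) with hEdef
    have hlast : ∀ i, i < m + 1 → F.form 1 (rotSeq (m + 2) (i + 1) y (m + 1) *
        ev f (rotSeq (m + 2) (i + 1) y)) = E i := by
      intro i hi
      have h1 : rotSeq (m + 2) (i + 1) y (m + 1) = y i := by
        have : ¬ (m + 1 + (i + 1) < m + 2) := by omega
        simp only [rotSeq, if_neg this]
        congr 1; omega
      rw [h1]
      simp only [hEdef]
      congr 3
      funext q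
      simp only [rotSeq]
      grind
    have hfirst : F.form 1 (rotSeq (m + 2) 0 y (m + 1) * ev f (rotSeq (m + 2) 0 y)) = E (m + 1) := by
      have h1 : rotSeq (m + 2) 0 y (m + 1) = y (m + 1) := by simp [rotSeq]
      rw [h1]
      simp only [hEdef]
      congr 2
      refine ev_congr _ fun q hq => ?_
      simp only [rotSeq]
      grind
    rw [Finset.sum_sub_distrib, Finset.sum_range_succ, Finset.sum_range_succ' (fun i =>
      (-1 : R) ^ ((i + 1) * (m + 1)) * _), hfirst]
    have hsum : ∑ i ∈ Finset.range (m + 1), (-1 : R) ^ ((i + 1 + 1) * (m + 1)) *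
        F.form 1 (rotSeq (m + 2) (i + 1) y (m + 1) * ev f (rotSeq (m + 2) (i + 1) y)) =
        ∑ i ∈ Finset.range (m + 1), (-1 : R) ^ (i * (m + 1)) * E i := by
      refine Finset.sum_congr rfl fun i hi => ?_
      rw [hlast i (Finset.mem_range.1 hi), neg_one_pow_congr (a := (i + 1 + 1) * (m + 1))]
      ring_nf; omega
    have hs : (-1 : R) ^ ((m + 1) * (m + 1)) = (-1 : R) ^ ((0 + 1) * (m + 1)) := by
      refine neg_one_pow_congr ?_
      have : Even (m * (m + 1)) := Nat.even_mul_succ_self m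
      obtain ⟨c, hc⟩ := this
      have : (m + 1) * (m + 1) = m * (m + 1) + (m + 1) := by ring
      omega
    rw [hsum, hs]
    simp only [hEdef]
    ring
  rw [Finset.sum_congr rfl hE, Finset.sum_add_distrib, hcan, add_zero, F.sum_faces_bv, neg_neg,
    Finset.sum_range_succ, Finset.sum_range_succ']
  -- A cyclic product at `j` is again a word `(b', a')`. For `j = m + 1` one has `b' = a_m b`, for
  -- `j = 0` one has `b' = b a_0`, and otherwise `b' = b`. By associativity and symmetry of the form
  -- these are the last, first and inner cofaces of `F.bv f` paired with `b`.
  have hbv : ∀ (j : ℕ) (b' : A) (a' : ℕ → A),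
      (∀ q < m + 1, consSeq b' a' q = cycMerge (m + 1) j y q) →
      ∑ r ∈ Finset.range (m + 1), (-1 : R) ^ (j + r * m) *
        F.form 1 (ev f (rotSeq (m + 1) r (cycMerge (m + 1) j y))) =
      (-1 : R) ^ j * F.form b' (ev (F.bv f) a') := by
    intro j b' a' h
    rw [F.form_bv, Finset.mul_sum]
    refine Finset.sum_congr rfl fun r hr => ?_
    have hr := Finset.mem_range.1 hr
    rw [pow_add, mul_assoc]
    congr 2
    refine congrArg _ (ev_congr f fun q hq => ?_)
    simp only [rotSeq]
    split_ifs with h'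
    · rw [h _ h']
    · rw [h _ (by omega)]
  rw [hbv (m + 1) (a m * b) a, hbv 0 (b * a 0) (fun q => a (q + 1)), Finset.sum_congr rfl fun j hj =>
    hbv (j + 1) b (mergeSeq j a) ?_, ev_diff, map_add, map_add, map_sum, map_smul, F.assoc,
    F.symm (a m * b), ← F.assoc (ev (F.bv f) a), F.symm _ b]
  · simp only [map_smul, smul_eq_mul]
    ring
  · intro q hq
    have hj := Finset.mem_range.1 hj
    simp only [consSeq, cycMerge, hy, mergeSeq]
    grind
  · intro q hq
    simp only [consSeq, cycMerge, hy, mergeSeq]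
    grind
  · intro q hq
    simp only [consSeq, cycMerge, hy, mergeSeq]
    grind

theorem bv_mem {m : ℕ} {f : MultilinearMap R (fun _ : Fin (m + 1) => A) A}
    (hf : f ∈ Cochain R A (m + 1)) : F.bv f ∈ Cochain R A m := by
  intro a q hq
  rw [F.bv_apply]
  refine Finset.sum_eq_zero fun j _ => Finset.sum_eq_zero fun i _ => ?_
  rw [hf (rotate i (F.basis j) a) (q.succ - i) (by simp [rotate, hq]), map_zero, zero_smul,
    smul_zero]

theorem bv_zero {m : ℕ} : F.bv (0 : MultilinearMap R (fun _ : Fin (m + 1) => A) A) = 0 := by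
  ext a
  simp [F.bv_apply]

theorem bv_mem_Cocycle {m : ℕ} {f : MultilinearMap R (fun _ : Fin (m + 1) => A) A}
    (hf : f ∈ Cocycle R A (m + 1)) : F.bv f ∈ Cocycle R A m := by
  refine mem_Cocycle.2 ⟨F.bv_mem hf.1, ?_⟩
  rw [F.diff_bv, (mem_Cocycle.1 hf).2, F.bv_zero, neg_zero]

end SymmetricForm

end BVChain

/-! ### The operator on cohomology, for commutative algebras -/

section BVComm

variable {R A : Type*} [CommRing R] [CommRing A] [Algebra R A] {ι : Type*} [Fintype ι]

/-- Immediate from `diff_bv`, except when the primitive has degree zero and the operator has no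
cochain to offer; its differential is then zero by commutativity. -/
theorem SymmetricForm.bv_mem_Coboundary (F : SymmetricForm R A ι) {m : ℕ}
    {f : MultilinearMap R (fun _ : Fin (m + 1) => A) A} (hf : f ∈ Coboundary R A (m + 1)) :
    F.bv f ∈ Coboundary R A m := by
  obtain ⟨u, hu, rfl⟩ := hf
  change F.bv (diff u) ∈ _
  cases m with
  | zero => rw [diff_eq_zero_of_comm, F.bv_zero]; exact Submodule.zero_mem _
  | succ m =>
    rw [← neg_neg (F.bv (diff u)), ← F.diff_bv]
    exact Submodule.neg_mem _ ⟨F.bv u, F.bv_mem hu, rfl⟩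

end BVComm

section GroupCochains

/-! ### Normalized cochains of a group with values in a bimodule -/

variable {G : Type*} [CommGroup G] {M : Type*} [AddCommGroup M]

/-- `(g_0, …, g_m) ↦ (g_0, …, g_j g_{j+1}, …, g_m)`. -/
def groupMerge {m : ℕ} (j : Fin m) (g : Fin (m + 1) → G) : Fin m → G := fun p =>
  if p < j then g p.castSucc else if p = j then g p.castSucc * g p.succ else g p.succ

/-- The differential of a group cochain without its last term. -/
def groupDiffInit (L : G →* AddMonoid.End M) {m : ℕ} (φ : (Fin m → G) → M) (g : Fin (m + 1) → G) :
    M :=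
  L (g 0) (φ (Fin.tail g)) + ∑ j : Fin m, (-1 : ℤ) ^ ((j : ℕ) + 1) • φ (groupMerge j g)

/-- The differential of the cochains of `G` with values in a bimodule, on which `G` acts from the
left by `L` and from the right by `T`. -/
def groupDiff (L T : G →* AddMonoid.End M) {m : ℕ} (φ : (Fin m → G) → M) (g : Fin (m + 1) → G) :
    M :=
  groupDiffInit L φ g + (-1 : ℤ) ^ (m + 1) • T (g (Fin.last m)) (φ (Fin.init g))

/-- A cochain is normalized if it vanishes as soon as one of its arguments is `1`. -/
def GroupNormalized {m : ℕ} (φ : (Fin m → G) → M) : Prop := ∀ g i, g i = 1 → φ g = 0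

theorem groupMerge_castSucc_snoc {m : ℕ} (j : Fin m) (g : Fin (m + 1) → G) (h : G) :
    groupMerge j.castSucc (Fin.snoc g h : Fin (m + 2) → G) =
      (Fin.snoc (groupMerge j g) h : Fin (m + 1) → G) := by
  funext p
  refine Fin.lastCases ?_ (fun p => ?_) p
  · have h1 : ¬ (Fin.last m < j.castSucc) := not_lt.2 (Fin.le_last _)
    have h2 : ¬ (Fin.last m = j.castSucc) := (Fin.castSucc_lt_last j).ne'
    rw [groupMerge, if_neg h1, if_neg h2, Fin.succ_last, Fin.snoc_last, Fin.snoc_last]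
  · rw [Fin.snoc_castSucc]
    simp only [groupMerge, Fin.castSucc_lt_castSucc_iff, Fin.castSucc_inj, Fin.succ_castSucc,
      Fin.snoc_castSucc]

theorem groupMerge_last_snoc {m : ℕ} (g : Fin (m + 1) → G) (h : G) :
    groupMerge (Fin.last m) (Fin.snoc g h : Fin (m + 2) → G) =
      (Fin.snoc (Fin.init g) (g (Fin.last m) * h) : Fin (m + 1) → G) := by
  funext p
  refine Fin.lastCases ?_ (fun p => ?_) p
  · rw [groupMerge, if_neg (lt_irrefl _), if_pos rfl, Fin.succ_last, Fin.snoc_last, Fin.snoc_last,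
      Fin.snoc_castSucc]
  · rw [groupMerge, if_pos (Fin.castSucc_lt_last p), Fin.snoc_castSucc, Fin.snoc_castSucc]
    rfl

theorem tail_snoc {X : Type*} {m : ℕ} (g : Fin (m + 1) → X) (h : X) :
    Fin.tail (Fin.snoc g h : Fin (m + 2) → X) = (Fin.snoc (Fin.tail g) h : Fin (m + 1) → X) := by
  funext p
  refine Fin.lastCases ?_ (fun p => ?_) p
  · rw [Fin.tail, Fin.succ_last, Fin.snoc_last, Fin.snoc_last]
  · rw [Fin.tail, Fin.succ_castSucc, Fin.snoc_castSucc, Fin.snoc_castSucc]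
    rfl

theorem groupDiffInit_snoc (L : G →* AddMonoid.End M) {m : ℕ} (φ : (Fin (m + 1) → G) → M)
    (g : Fin (m + 1) → G) (h : G) :
    groupDiffInit L φ (Fin.snoc g h : Fin (m + 2) → G) =
      groupDiffInit L (fun g' => φ (Fin.snoc g' h : Fin (m + 1) → G)) g +
        (-1 : ℤ) ^ (m + 1) • φ (Fin.snoc (Fin.init g) (g (Fin.last m) * h) : Fin (m + 1) → G) := by
  have h0 : (Fin.snoc g h : Fin (m + 2) → G) 0 = g 0 := Fin.snoc_castSucc (α := fun _ => G) h g 0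
  unfold groupDiffInit
  rw [Fin.sum_univ_castSucc, h0, tail_snoc, groupMerge_last_snoc, ← add_assoc]
  simp only [groupMerge_castSucc_snoc]
  rfl

/-! ### Shifting the degree -/

variable (G M) in
/-- The normalized cochains of degree one. -/
def shiftModule : AddSubgroup (G → M) where
  carrier := {φ | φ 1 = 0}
  add_mem' {a b} ha hb := by
    change a 1 + b 1 = 0
    rw [show a 1 = 0 from ha, show b 1 = 0 from hb, add_zero]
  zero_mem' := rfl
  neg_mem' {a} ha := by
    change -a 1 = 0
    rw [show a 1 = 0 from ha, neg_zero]

/-- The left action `(g φ)(h) = g φ(h)`. -/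
def shiftLeft (L : G →* AddMonoid.End M) : G →* AddMonoid.End (shiftModule G M) where
  toFun g :=
    { toFun := fun φ => ⟨fun h => L g (φ.1 h), by
        change L g (φ.1 1) = 0
        rw [show φ.1 1 = 0 from φ.2, map_zero]⟩
      map_zero' := Subtype.ext <| funext fun h => map_zero (L g)
      map_add' := fun φ ψ => Subtype.ext <| funext fun h => map_add (L g) _ _ }
  map_one' := by
    ext φ h
    change L 1 (φ.1 h) = φ.1 h
    rw [map_one]; rfl
  map_mul' g g' := by
    ext φ h
    change L (g * g') (φ.1 h) = L g (L g' (φ.1 h))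
    rw [map_mul]; rfl

/-- The right action `(φ g)(h) = φ(gh) - φ(g)h`. -/
def shiftRight (T : G →* AddMonoid.End M) : G →* AddMonoid.End (shiftModule G M) where
  toFun g :=
    { toFun := fun φ => ⟨fun h => φ.1 (g * h) - T h (φ.1 g), by
        change φ.1 (g * 1) - T 1 (φ.1 g) = 0
        rw [mul_one, map_one]; exact sub_self _⟩
      map_zero' := Subtype.ext <| funext fun h => by
        change (0 : M) - T h 0 = 0
        rw [map_zero, sub_zero]
      map_add' := fun φ ψ => Subtype.ext <| funext fun h => by
        change φ.1 (g * h) + ψ.1 (g * h) - T h (φ.1 g + ψ.1 g) =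
          (φ.1 (g * h) - T h (φ.1 g)) + (ψ.1 (g * h) - T h (ψ.1 g))
        rw [map_add]; abel }
  map_one' := by
    ext φ h
    change φ.1 (1 * h) - T h (φ.1 1) = φ.1 h
    rw [show φ.1 1 = 0 from φ.2, map_zero, sub_zero, one_mul]
  map_mul' g g' := by
    -- A right action is in general an antihomomorphism; commutativity of `G` makes it a
    -- homomorphism.
    ext φ h
    change φ.1 (g * g' * h) - T h (φ.1 (g * g')) =
      (φ.1 (g' * (g * h)) - T (g * h) (φ.1 g')) - T h (φ.1 (g' * g) - T g (φ.1 g'))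
    rw [mul_comm g h, map_mul, map_sub, mul_comm h g, ← mul_assoc, mul_comm g' g]
    change _ = _ - T h (T g _) - _
    abel

/-- A normalized cochain of degree `m + 1`, viewed as a cochain of degree `m`. -/
def curryLast {m : ℕ} (φ : (Fin (m + 1) → G) → M) (hφ : GroupNormalized φ) (g : Fin m → G) :
    shiftModule G M :=
  ⟨fun h => φ (Fin.snoc g h : Fin (m + 1) → G), hφ _ (Fin.last m) (Fin.snoc_last _ _)⟩

/-- A cochain of degree `m` with values in `shiftModule G M`, viewed as a cochain of degree
`m + 1`. -/
def uncurryLast {m : ℕ} (φ : (Fin m → G) → shiftModule G M) (g : Fin (m + 1) → G) : M :=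
  (φ (Fin.init g)).1 (g (Fin.last m))

theorem uncurryLast_snoc {m : ℕ} (φ : (Fin m → G) → shiftModule G M) (g : Fin m → G) (h : G) :
    uncurryLast φ (Fin.snoc g h : Fin (m + 1) → G) = (φ g).1 h := by
  rw [uncurryLast, Fin.init_snoc, Fin.snoc_last]

theorem GroupNormalized.curryLast {m : ℕ} {φ : (Fin (m + 1) → G) → M} (hφ : GroupNormalized φ) :
    GroupNormalized (curryLast φ hφ) := fun g i hi =>
  Subtype.ext <| funext fun h => hφ _ i.castSucc (by rw [Fin.snoc_castSucc, hi])

theorem GroupNormalized.uncurryLast {m : ℕ} {φ : (Fin m → G) → shiftModule G M}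
    (hφ : GroupNormalized φ) : GroupNormalized (uncurryLast φ) := by
  intro g i
  refine Fin.lastCases (fun h => ?_) (fun j h => ?_) i
  · rw [Hochschild.uncurryLast, h]
    exact (φ (Fin.init g)).2
  · rw [Hochschild.uncurryLast, hφ (Fin.init g) j h]
    rfl

/-- Dimension shifting. The terms of the differential that touch the last argument `h`, namely `φ(…,
g_m h)` and `φ(…, g_m) h`, have opposite signs and together form the right action of `g_m` on
`shiftModule G M`. -/
theorem groupDiff_uncurryLast (L T : G →* AddMonoid.End M) {m : ℕ}
    (φ : (Fin m → G) → shiftModule G M) (g : Fin (m + 1) → G) (h : G) :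
    groupDiff L T (uncurryLast φ) (Fin.snoc g h : Fin (m + 2) → G) =
      (groupDiff (shiftLeft L) (shiftRight T) φ g).1 h := by
  have e : ∀ s : Fin m → shiftModule G M, (∑ j, s j).1 h = ∑ j, (s j).1 h := by
    intro s
    rw [AddSubgroup.val_finsetSum, Finset.sum_apply]
  have e1 : (groupDiff (shiftLeft L) (shiftRight T) φ g).1 h =
      L (g 0) ((φ (Fin.tail g)).1 h) +
        ∑ j : Fin m, (-1 : ℤ) ^ ((j : ℕ) + 1) • (φ (groupMerge j g)).1 h +
        (-1 : ℤ) ^ (m + 1) • ((φ (Fin.init g)).1 (g (Fin.last m) * h) -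
          T h ((φ (Fin.init g)).1 (g (Fin.last m)))) := by
    change L (g 0) ((φ (Fin.tail g)).1 h) +
      (∑ j : Fin m, (-1 : ℤ) ^ ((j : ℕ) + 1) • φ (groupMerge j g)).1 h + _ = _
    rw [e]
    rfl
  rw [e1, groupDiff, groupDiffInit_snoc, Fin.snoc_last, Fin.init_snoc, uncurryLast_snoc]
  simp only [groupDiffInit, uncurryLast_snoc]
  rw [pow_succ (-1 : ℤ) (m + 1), smul_sub, mul_neg_one, neg_smul, uncurryLast]
  abel

end GroupCochains

/-! ### Cocycles of a cyclic group and the carry cocycle -/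

section Cyclic

variable {n : ℕ}

/-- The generator of the cyclic group. -/
def gen (n : ℕ) : Multiplicative (ZMod n) := Multiplicative.ofAdd 1

/-- The exponent of an element of the cyclic group. -/
def expo (g : Multiplicative (ZMod n)) : ℕ := ZMod.val (Multiplicative.toAdd g)

theorem expo_one : expo (1 : Multiplicative (ZMod n)) = 0 := ZMod.val_zero

theorem expo_gen_pow (i : ℕ) : expo (gen n ^ i) = i % n := by
  have : Multiplicative.toAdd (gen n ^ i) = (i : ZMod n) := by
    rw [toAdd_pow, gen, toAdd_ofAdd, nsmul_one]
  rw [expo, this, ZMod.val_natCast]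

theorem gen_pow_card : gen n ^ n = 1 := by
  apply Multiplicative.toAdd.injective
  rw [toAdd_pow, gen, toAdd_ofAdd, nsmul_one, ZMod.natCast_self, toAdd_one]

theorem expo_gen (hn : 1 < n) : expo (gen n) = 1 := by
  have := expo_gen_pow (n := n) 1
  rwa [pow_one, Nat.mod_eq_of_lt hn] at this

variable [NeZero n]

theorem expo_lt (g : Multiplicative (ZMod n)) : expo g < n := ZMod.val_lt _

theorem expo_mul (g h : Multiplicative (ZMod n)) : expo (g * h) = (expo g + expo h) % n :=
  ZMod.val_add _ _

theorem gen_pow_expo (g : Multiplicative (ZMod n)) : gen n ^ expo g = g := by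
  apply Multiplicative.toAdd.injective
  rw [toAdd_pow, gen, toAdd_ofAdd, nsmul_one, expo, ZMod.natCast_zmod_val]

/-- The carry of the addition of exponents. -/
def carry (g h : Multiplicative (ZMod n)) : ℕ := (expo g + expo h) / n

theorem carry_add (g h : Multiplicative (ZMod n)) :
    n * carry g h + expo (g * h) = expo g + expo h := by
  rw [carry, expo_mul, Nat.div_add_mod]

/-- Multiplied by `n`, both sides are `expo g + expo h + expo k` minus the exponent of the product.
-/
theorem carry_cocycle (g h k : Multiplicative (ZMod n)) :
    carry h k + carry g (h * k) = carry (g * h) k + carry g h := by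
  have h1 := carry_add h k
  have h2 := carry_add g (h * k)
  have h3 := carry_add (g * h) k
  have h4 := carry_add g h
  rw [mul_assoc] at h3
  have : n * (carry h k + carry g (h * k)) = n * (carry (g * h) k + carry g h) := by
    rw [mul_add, mul_add]; omega
  exact Nat.eq_of_mul_eq_mul_left (Nat.pos_of_ne_zero (NeZero.ne n)) this

theorem carry_one_right (g : Multiplicative (ZMod n)) : carry g 1 = 0 := by
  rw [carry, expo_one, add_zero, Nat.div_eq_of_lt (expo_lt g)]

theorem carry_one_left (g : Multiplicative (ZMod n)) : carry 1 g = 0 := by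
  rw [carry, expo_one, zero_add, Nat.div_eq_of_lt (expo_lt g)]

variable {M : Type*} [AddCommGroup M]

/-- A normalized two-cocycle of the cyclic group is the product of an invariant element with the
carry cocycle, up to a coboundary. -/
theorem exists_carry_of_cocycle (L T : Multiplicative (ZMod n) →* AddMonoid.End M)
    (hLT : ∀ g h a, L g (T h a) = T h (L g a))
    (f : Multiplicative (ZMod n) → Multiplicative (ZMod n) → M) (h1 : ∀ g, f 1 g = 0)
    (h2 : ∀ g, f g 1 = 0)
    (hf : ∀ g h k, L g (f h k) - f (g * h) k + f g (h * k) - T k (f g h) = 0) :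
    ∃ (c : M) (u : Multiplicative (ZMod n) → M), u 1 = 0 ∧ (∀ g, L g c = T g c) ∧
      ∀ g h, f g h = carry g h • L (g * h) c + (L g (u h) - u (g * h) + T h (u g)) := by
  have Lmul : ∀ g h a, L (g * h) a = L g (L h a) := fun g h a => by rw [map_mul]; rfl
  have Tmul : ∀ g h a, T (g * h) a = T g (T h a) := fun g h a => by rw [map_mul]; rfl
  have Lone : ∀ a, L 1 a = a := fun a => by rw [map_one]; rfl
  have Tone : ∀ a, T 1 a = a := fun a => by rw [map_one]; rfl
  rcases Nat.lt_or_ge 1 n with hn | hn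
  swap
  · obtain rfl : n = 1 := le_antisymm hn (Nat.pos_of_ne_zero (NeZero.ne n))
    refine ⟨0, fun _ => 0, rfl, fun g => by rw [map_zero, map_zero], fun g h => ?_⟩
    rw [Subsingleton.elim g 1, h1]
    simp
  -- The recursion is what is needed for `F = f + du` to vanish at `(gen n ^ i, gen n)` as long as
  -- no carry occurs.
  let U : ℕ → M := fun i => Nat.rec 0 (fun i a => T (gen n) a + f (gen n ^ i) (gen n)) i
  have U0 : U 0 = 0 := rfl
  have U1 : ∀ i, U (i + 1) = T (gen n) (U i) + f (gen n ^ i) (gen n) := fun i => rfl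
  set u : Multiplicative (ZMod n) → M := fun g => U (expo g) with hu
  have u1 : u 1 = 0 := by rw [hu]; simp only [expo_one, U0]
  obtain ⟨F, hF⟩ : ∃ F : Multiplicative (ZMod n) → Multiplicative (ZMod n) → M, ∀ g h,
    F g h = f g h + (L g (u h) - u (g * h) + T h (u g)) := ⟨_, fun _ _ => rfl⟩
  have F1 : ∀ g, F 1 g = 0 := fun g => by
    rw [hF, h1, Lone, one_mul, u1, map_zero]; abel
  have F2 : ∀ g, F g 1 = 0 := fun g => by
    rw [hF, h2, Tone, mul_one, u1, map_zero]; abel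
  have Fc : ∀ g h k, F g (h * k) = T k (F g h) + F (g * h) k - L g (F h k) := by
    intro g h k
    have e := hf g h k
    simp only [hF, map_add, map_sub, ← hLT, ← Lmul, ← Tmul, mul_assoc]
    rw [mul_comm k h]
    have e' : f g (h * k) = T k (f g h) + f (g * h) k - L g (f h k) := by
      rw [← sub_eq_zero, ← e]; abel
    rw [e']
    abel
  have ugen : u (gen n) = 0 := by
    have := U1 0
    rw [U0, map_zero, zero_add, pow_zero, h1] at this
    rw [hu]; simp only [expo_gen hn]; rw [← add_zero (0 : M), ← this]
  have Fx : ∀ i, i + 1 < n → F (gen n ^ i) (gen n) = 0 := by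
    intro i hi
    have e1 : u (gen n ^ i) = U i := by
      rw [hu]; simp only [expo_gen_pow, Nat.mod_eq_of_lt (Nat.lt_of_succ_lt hi)]
    have e2 : u (gen n ^ i * gen n) = U (i + 1) := by
      rw [hu, ← pow_succ]; simp only [expo_gen_pow, Nat.mod_eq_of_lt hi]
    rw [hF, ugen, map_zero, e1, e2, U1]
    abel
  -- The first carry: the only value of `F` at a pair `(·, gen n)` that can survive.
  set c : M := F (gen n ^ (n - 1)) (gen n) with hc
  have Fgen : ∀ j, j + 1 < n → F (gen n) (gen n ^ j) = 0 := by
    intro j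
    induction j with
    | zero => intro _; rw [pow_zero, F2]
    | succ j ih =>
      intro hj
      rw [pow_succ, Fc, ih (by omega), ← pow_succ', Fx _ hj, Fx _ (by omega), map_zero, map_zero]
      abel
  have Flast : F (gen n) (gen n ^ (n - 1)) = c := by
    obtain ⟨j, rfl⟩ : ∃ j, n = j + 2 := ⟨n - 2, by omega⟩
    rw [hc, show j + 2 - 1 = j + 1 by omega, pow_succ, Fc, Fgen j (by omega), ← pow_succ',
      Fx j (by omega), map_zero, map_zero, pow_succ]
    abel
  -- The cocycle identity at `(gen n, gen n ^ (n - 1), gen n)`, where both products are `1` and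
  -- normalization leaves only the two terms in `c`.
  have hgc : L (gen n) c = T (gen n) c := by
    have e := Fc (gen n) (gen n ^ (n - 1)) (gen n)
    have e0 : n - 1 + 1 = n := by omega
    rw [← pow_succ, ← pow_succ', e0, gen_pow_card, F2, F1, Flast, ← hc, add_zero] at e
    exact (sub_eq_zero.1 e.symm).symm
  have hinv : ∀ g, L g c = T g c := by
    intro g
    rw [← gen_pow_expo g]
    induction expo g with
    | zero => rw [pow_zero, Lone, Tone]
    | succ i ih => rw [pow_succ, Lmul, Tmul, hgc, hLT, ih, ← Tmul, ← Tmul, mul_comm]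
  -- The cocycle identity passes from `gen n ^ j` to `gen n ^ (j + 1)` at the cost of `F (g * gen n
  -- ^ j) (gen n)`. This is `c` if the exponent of `g * gen n ^ j` is `n - 1`, which is when the
  -- carry jumps by one, and zero otherwise.
  have main : ∀ g j, j < n → F g (gen n ^ j) = carry g (gen n ^ j) • L (g * gen n ^ j) c := by
    intro g j
    induction j with
    | zero => intro _; rw [pow_zero, F2, carry_one_right, zero_smul]
    | succ j ih =>
      intro hj
      have ec : carry g (gen n ^ (j + 1)) = carry g (gen n ^ j) +
          if n ∣ expo g + j + 1 then 1 else 0 := by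
        rw [carry, carry, expo_gen_pow, expo_gen_pow, Nat.mod_eq_of_lt hj,
          Nat.mod_eq_of_lt (Nat.lt_of_succ_lt hj), ← add_assoc, Nat.succ_div]
      have ex : expo (g * gen n ^ j) = (expo g + j) % n := by
        rw [expo_mul, expo_gen_pow, Nat.mod_eq_of_lt (Nat.lt_of_succ_lt hj)]
      have ey : g * gen n ^ j = gen n ^ (expo g + j) := by
        rw [pow_add, gen_pow_expo]
      rw [pow_succ, Fc, ih (by omega), Fx j hj, map_zero, sub_zero, ← pow_succ, ec, add_smul,
        map_nsmul, ← hLT, ← hgc, ← Lmul, mul_assoc, ← pow_succ]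
      congr 1
      split_ifs with hd
      · have e1 : g * gen n ^ (j + 1) = 1 := by
          obtain ⟨q, hq⟩ := hd
          rw [pow_succ, ← mul_assoc, ey, ← pow_succ, hq, pow_mul, gen_pow_card, one_pow]
        have e2 : g * gen n ^ j = gen n ^ (n - 1) := by
          rw [← gen_pow_expo (g * gen n ^ j), ex]
          congr 1
          obtain ⟨q, hq⟩ := hd
          obtain ⟨q, rfl⟩ : ∃ q', q = q' + 1 :=
            -- The quotient `q` is not zero, as `n * q` is a successor.
            ⟨q - 1, by rcases q with _ | q <;> [simp at hq; rfl]⟩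
          rw [show expo g + j = (n - 1) + n * q by rw [mul_add] at hq; omega,
            Nat.add_mul_mod_self_left, Nat.mod_eq_of_lt (by omega)]
        rw [one_smul, e1, Lone, e2]
      · rw [zero_smul, ← gen_pow_expo (g * gen n ^ j), ex]
        refine Fx _ ?_
        have hlt := Nat.mod_lt (expo g + j) (Nat.pos_of_ne_zero (NeZero.ne n))
        refine lt_of_le_of_ne hlt fun he => hd ?_
        refine ⟨(expo g + j) / n + 1, ?_⟩
        have := Nat.div_add_mod (expo g + j) n
        rw [mul_add]; omega
  refine ⟨c, fun g => -u g, by simp only [u1, neg_zero], hinv, fun g h => ?_⟩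
  have e := main g (expo h) (expo_lt h)
  rw [gen_pow_expo, hF] at e
  simp only [← e, map_neg]
  abel

theorem exists_carry_of_groupDiff_eq_zero_two (L T : Multiplicative (ZMod n) →* AddMonoid.End M)
    (hLT : ∀ g h a, L g (T h a) = T h (L g a))
    (f : (Fin 2 → Multiplicative (ZMod n)) → M) (hf : GroupNormalized f)
    (hd : ∀ g, groupDiff L T f g = 0) :
    ∃ (c : (Fin 0 → Multiplicative (ZMod n)) → M) (u : (Fin 1 → Multiplicative (ZMod n)) → M),
      GroupNormalized c ∧ GroupNormalized u ∧ (∀ g, groupDiff L T c g = 0) ∧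
      ∀ g, f g = carry (g 0) (g 1) • L (g 0 * g 1) (c fun i => g i.succ.succ) +
        groupDiff L T u g := by
  obtain ⟨c, u, hu, hc, h⟩ := exists_carry_of_cocycle L T hLT (fun g h => f ![g, h])
    (fun g => hf _ 0 rfl) (fun g => hf _ 1 rfl) (fun g h k => by
      have e := hd ![g, h, k]
      simp only [groupDiff, groupDiffInit, Fin.sum_univ_two] at e
      have e1 : Fin.tail ![g, h, k] = ![h, k] := rfl
      have e2 : Fin.init ![g, h, k] = ![g, h] := by funext i; fin_cases i <;> rfl
      have e3 : groupMerge 0 ![g, h, k] = ![g * h, k] := by funext i; fin_cases i <;> rfl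
      have e4 : groupMerge 1 ![g, h, k] = ![g, h * k] := by funext i; fin_cases i <;> rfl
      have e5 : ![g, h, k] 0 = g := rfl
      have e6 : ![g, h, k] (Fin.last 2) = k := rfl
      rw [e1, e2, e3, e4, e5, e6] at e
      rw [← e]
      simp
      abel)
  refine ⟨fun _ => c, fun g => u (g 0), fun g i => i.elim0, fun g i hi => ?_, fun g => ?_,
    fun g => ?_⟩
  · obtain rfl : i = 0 := Subsingleton.elim i 0
    simp only [hi, hu]
  · simp [groupDiff, groupDiffInit, hc]
  · have e : g = ![g 0, g 1] := by funext i; fin_cases i <;> rfl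
    have e' := h (g 0) (g 1)
    rw [← e] at e'
    rw [e']
    simp [groupDiff, groupDiffInit, Fin.tail, Fin.init, groupMerge, sub_eq_add_neg]

/-- Normalized cocycles of degree `m + 2` are products of cocycles of degree `m` with the carry
cocycle, up to coboundaries. -/
theorem exists_carry_of_groupDiff_eq_zero (m : ℕ) : ∀ {M : Type*} [AddCommGroup M]
    (L T : Multiplicative (ZMod n) →* AddMonoid.End M) (_ : ∀ g h a, L g (T h a) = T h (L g a))
    (f : (Fin (m + 2) → Multiplicative (ZMod n)) → M) (_ : GroupNormalized f)
    (_ : ∀ g, groupDiff L T f g = 0),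
    ∃ (c : (Fin m → Multiplicative (ZMod n)) → M)
      (u : (Fin (m + 1) → Multiplicative (ZMod n)) → M),
      GroupNormalized c ∧ GroupNormalized u ∧ (∀ g, groupDiff L T c g = 0) ∧
      ∀ g, f g = carry (g 0) (g 1) • L (g 0 * g 1) (c fun i => g i.succ.succ) +
        groupDiff L T u g := by
  induction m with
  | zero =>
    intro M _ L T hLT f hf hd
    exact exists_carry_of_groupDiff_eq_zero_two L T hLT f hf hd
  -- The induction hypothesis is applied to `shiftModule`, hence the quantification over all
  -- coefficients. Currying removes the last argument and keeps the left action pointwise, so the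
  -- carry factor in the first two arguments is unaffected.
  | succ m ih =>
    intro M _ L T hLT f hf hd
    have hunc : uncurryLast (curryLast f hf) = f := by
      funext g
      change f (Fin.snoc (Fin.init g) (g (Fin.last _)) : Fin (m + 3) → _) = f g
      rw [Fin.snoc_init_self]
    obtain ⟨c, u, hc, hu, hcd, h⟩ := ih (shiftLeft L) (shiftRight T)
      (fun g h φ => Subtype.ext <| funext fun k => by
        change L g (φ.1 (h * k) - T k (φ.1 h)) = L g (φ.1 (h * k)) - T k (L g (φ.1 h))
        rw [map_sub, hLT])
      (curryLast f hf) hf.curryLast (fun g => Subtype.ext <| funext fun k => by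
        rw [← groupDiff_uncurryLast, hunc, hd]
        rfl)
    have hsn : ∀ {k : ℕ} (g : Fin (k + 1) → Multiplicative (ZMod n)),
        g = (Fin.snoc (Fin.init g) (g (Fin.last k)) : Fin (k + 1) → Multiplicative (ZMod n)) :=
      fun g => (Fin.snoc_init_self g).symm
    refine ⟨uncurryLast c, uncurryLast u, hc.uncurryLast, hu.uncurryLast, fun g => ?_, fun g => ?_⟩
    · rw [hsn g, groupDiff_uncurryLast, hcd]
      rfl
    · have e := congrArg (fun φ => φ.1 (g (Fin.last _))) (h (Fin.init g))
      conv_lhs => rw [hsn g]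
      have e2 : groupDiff L T (uncurryLast u) g =
          (groupDiff (shiftLeft L) (shiftRight T) u (Fin.init g)).1 (g (Fin.last _)) := by
        rw [← groupDiff_uncurryLast, ← hsn g]
      rw [e2]
      exact e

end Cyclic

/-! ### The trace lowering degrees by two -/

section Trace

variable {G : Type*} [CommGroup G] [Fintype G] {M : Type*} [AddCommGroup M]

/-- The chain map `φ ↦ ∑_h φ(…, h, x) (hx)⁻¹` of degree `-2`. -/
def groupTrace (T : G →* AddMonoid.End M) (x : G) {m : ℕ} (φ : (Fin (m + 2) → G) → M)
    (g : Fin m → G) : M :=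
  ∑ h : G, T (h * x)⁻¹ (φ (Fin.snoc (Fin.snoc g h : Fin (m + 1) → G) x : Fin (m + 2) → G))

/-- Two translations of the summation variable. Replacing `h` by `g_m h` turns the coface that
multiplies `g_m` and `h` into the right action of `g_m`; replacing `h` by `h x` makes `φ(…, h x)`
cancel against `φ(…, h) x`. -/
theorem groupTrace_groupDiff (T : G →* AddMonoid.End M) (x : G) {m : ℕ}
    (φ : (Fin (m + 2) → G) → M) (g : Fin (m + 1) → G) :
    groupTrace T x (groupDiff T T φ) g = groupDiff T T (groupTrace T x φ) g := by
  have Tmul : ∀ g h a, T (g * h) a = T g (T h a) := fun g h a => by rw [map_mul]; rfl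
  have e1 : ∑ h : G, T (h * x)⁻¹ (groupDiffInit T (fun g' => φ (Fin.snoc (Fin.snoc g' h :
      Fin (m + 1) → G) x : Fin (m + 2) → G)) g) = groupDiffInit T (groupTrace T x φ) g := by
    simp only [groupDiffInit, groupTrace, map_add, map_sum, map_zsmul, Finset.smul_sum,
      Finset.sum_add_distrib]
    congr 1
    · refine Finset.sum_congr rfl fun h _ => ?_
      rw [← Tmul, ← Tmul, mul_comm]
    · exact Finset.sum_comm
  have e2 : ∑ h : G, T (h * x)⁻¹ (φ (Fin.snoc (Fin.snoc (Fin.init g) (g (Fin.last m) * h) :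
      Fin (m + 1) → G) x : Fin (m + 2) → G)) =
      T (g (Fin.last m)) (groupTrace T x φ (Fin.init g)) := by
    rw [groupTrace, map_sum]
    refine Fintype.sum_equiv (Equiv.mulLeft (g (Fin.last m))) _ _ fun h => ?_
    rw [← Tmul, Equiv.coe_mulLeft]
    congr 2
    rw [mul_assoc, mul_inv (g (Fin.last m)), mul_inv_cancel_left]
  have e3 : ∑ h : G, T (h * x)⁻¹ (φ (Fin.snoc g (h * x) : Fin (m + 2) → G)) =
      ∑ h : G, T (h * x)⁻¹ (T x (φ (Fin.snoc g h : Fin (m + 2) → G))) := by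
    refine Fintype.sum_equiv (Equiv.mulRight x) _ _ fun h => ?_
    rw [← Tmul, Equiv.coe_mulRight]
    congr 2
    simp [mul_comm]
  rw [groupTrace]
  simp only [groupDiff, groupDiffInit_snoc, Fin.snoc_last, Fin.init_snoc, map_add, map_zsmul,
    Finset.sum_add_distrib, ← Finset.smul_sum, e1, e2, e3]
  rw [pow_succ (-1 : ℤ) (m + 1 + 1), mul_neg_one, neg_smul]
  abel

/-- At the bottom the first coface `h φ(x)` has no counterpart in lower degree. After multiplication
by `(hx)⁻¹` it no longer depends on `h`, hence the factor `|G|`; this is the origin of the relation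
`n z = 0`. -/
theorem groupTrace_groupDiff_one (T : G →* AddMonoid.End M) (x : G) (φ : (Fin 1 → G) → M)
    (g : Fin 0 → G) :
    groupTrace T x (groupDiff T T φ) g = Fintype.card G • T x⁻¹ (φ fun _ => x) := by
  have Tmul : ∀ g h a, T (g * h) a = T g (T h a) := fun g h a => by rw [map_mul]; rfl
  have e : ∀ h, groupDiff T T φ (Fin.snoc (Fin.snoc g h : Fin 1 → G) x : Fin 2 → G) =
      T h (φ fun _ => x) - φ (fun _ => h * x) + T x (φ fun _ => h) := by
    intro h
    have f1 : Fin.tail (Fin.snoc (Fin.snoc g h : Fin 1 → G) x : Fin 2 → G) = fun _ => x := by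
      funext i; fin_cases i; rfl
    have f2 : groupMerge 0 (Fin.snoc (Fin.snoc g h : Fin 1 → G) x : Fin 2 → G) =
        fun _ => h * x := by
      funext i; fin_cases i; rfl
    have f3 : (Fin.snoc g h : Fin 1 → G) = fun _ => h := by
      funext i; fin_cases i; rfl
    rw [groupDiff, groupDiffInit, Fin.init_snoc, Fin.snoc_last, f1, Fin.sum_univ_one, f2, f3]
    have f4 : (Fin.snoc (fun _ => h : Fin 1 → G) x : Fin 2 → G) 0 = h := rfl
    rw [f4]
    simp [sub_eq_add_neg]
  have e3 : ∑ h : G, T (h * x)⁻¹ (φ fun _ => h * x) = ∑ h : G, T (h * x)⁻¹ (T x (φ fun _ => h)) := by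
    refine Fintype.sum_equiv (Equiv.mulRight x) _ _ fun h => ?_
    rw [← Tmul, Equiv.coe_mulRight]
    congr 2
    simp [mul_comm]
  rw [groupTrace]
  simp only [e, map_add, map_sub, Finset.sum_add_distrib, Finset.sum_sub_distrib, e3]
  rw [sub_add_cancel, ← Finset.card_univ, ← Finset.sum_const]
  refine Finset.sum_congr rfl fun h _ => ?_
  rw [← Tmul]
  congr 2
  group

end Trace

section Restriction

/-! ### Cochains of a group algebra as group cochains -/

variable (R : Type*) [CommRing R] {G : Type*} [CommGroup G]

/-- The action of `G` on its group algebra by multiplication. -/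
def mulAct (G : Type*) [CommGroup G] : G →* AddMonoid.End (MonoidAlgebra R G) :=
  (Module.toAddMonoidEnd (MonoidAlgebra R G) (MonoidAlgebra R G) : _ →* _).comp
    (MonoidAlgebra.of R G)

variable {R}

theorem mulAct_apply (g : G) (a : MonoidAlgebra R G) :
    mulAct R G g a = MonoidAlgebra.single g 1 * a := rfl

theorem mulAct_comm (g h : G) (a : MonoidAlgebra R G) :
    mulAct R G g (mulAct R G h a) = mulAct R G h (mulAct R G g a) := by
  simp only [mulAct_apply, mul_left_comm]

/-- The values of a cochain on group elements. -/
def onGroup {m : ℕ} (f : MultilinearMap R (fun _ : Fin m => MonoidAlgebra R G) (MonoidAlgebra R G))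
    (g : Fin m → G) : MonoidAlgebra R G :=
  f fun i => MonoidAlgebra.single (g i) 1

theorem onGroup_injective {X : Type*} {m : ℕ}
    {f f' : MultilinearMap R (fun _ : Fin m => MonoidAlgebra R X) (MonoidAlgebra R X)}
    (h : ∀ g, onGroup f g = onGroup f' g) : f = f' := by
  refine Module.Basis.ext_multilinear (fun _ => MonoidAlgebra.basis X R) fun g => ?_
  simpa only [MonoidAlgebra.basis_apply, onGroup] using h g

/-- Multiplication from the right is the same action as from the left because the group algebra is
commutative. -/
theorem onGroup_diff {m : ℕ}
    (f : MultilinearMap R (fun _ : Fin m => MonoidAlgebra R G) (MonoidAlgebra R G))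
    (g : Fin (m + 1) → G) :
    onGroup (diff f) g = groupDiff (mulAct R G) (mulAct R G) (onGroup f) g := by
  have hm : ∀ j : Fin m, merge j (fun i => (MonoidAlgebra.single (g i) 1 : MonoidAlgebra R G)) =
      fun i => MonoidAlgebra.single (groupMerge j g i) 1 := by
    intro j
    funext p
    unfold merge groupMerge
    split_ifs
    · rfl
    · rw [MonoidAlgebra.single_mul_single, one_mul]
    · rfl
  have hs : ∀ (k : ℕ) (a : MonoidAlgebra R G), (-1 : R) ^ k • a = (-1 : ℤ) ^ k • a := by
    intro k a
    rcases Nat.even_or_odd k with h | h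
    · rw [h.neg_one_pow, h.neg_one_pow, one_smul, one_smul]
    · rw [h.neg_one_pow, h.neg_one_pow, neg_smul, neg_smul, one_smul, one_smul]
  rw [onGroup, diff_apply]
  simp only [hm, hs, groupDiff, groupDiffInit, mulAct_apply]
  rw [mul_comm (f _) (MonoidAlgebra.single _ _)]
  rfl

theorem GroupNormalized.onGroup {m : ℕ}
    {f : MultilinearMap R (fun _ : Fin m => MonoidAlgebra R G) (MonoidAlgebra R G)}
    (hf : f ∈ Cochain R (MonoidAlgebra R G) m) : GroupNormalized (onGroup f) :=
  fun g i hi => hf _ i (by rw [hi]; rfl)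

theorem coord_single {X : Type*} [DecidableEq X] (g h : X) :
    (MonoidAlgebra.basis X R).coord g (MonoidAlgebra.single h 1) = if h = g then 1 else 0 := by
  rw [← MonoidAlgebra.basis_apply, Module.Basis.coord_apply, Module.Basis.repr_self,
    Finsupp.single_apply]

variable [Fintype G]

/-- The multilinear extension of a group cochain. -/
def ofGroup {m : ℕ} (φ : (Fin m → G) → MonoidAlgebra R G) :
    MultilinearMap R (fun _ : Fin m => MonoidAlgebra R G) (MonoidAlgebra R G) :=
  ∑ g : Fin m → G, ((MultilinearMap.mkPiAlgebra R (Fin m) R).compLinearMap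
    fun i => (MonoidAlgebra.basis G R).coord (g i)).smulRight (φ g)

theorem ofGroup_apply {m : ℕ} (φ : (Fin m → G) → MonoidAlgebra R G)
    (a : Fin m → MonoidAlgebra R G) :
    ofGroup φ a = ∑ g : Fin m → G, (∏ i, (MonoidAlgebra.basis G R).coord (g i) (a i)) • φ g := by
  simp only [ofGroup, sum_apply, MultilinearMap.smulRight_apply,
    MultilinearMap.compLinearMap_apply, MultilinearMap.mkPiAlgebra_apply]

theorem onGroup_ofGroup {m : ℕ} (φ : (Fin m → G) → MonoidAlgebra R G) (g : Fin m → G) :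
    onGroup (ofGroup φ) g = φ g := by
  classical
  rw [onGroup, ofGroup_apply, Finset.sum_eq_single g]
  · simp only [coord_single, if_true, Finset.prod_const_one, one_smul]
  · intro h _ hne
    obtain ⟨i, hi⟩ := Function.ne_iff.1 hne
    rw [Finset.prod_eq_zero (Finset.mem_univ i), zero_smul]
    rw [coord_single, if_neg (Ne.symm hi)]
  · simp

theorem GroupNormalized.ofGroup_mem {m : ℕ} {φ : (Fin m → G) → MonoidAlgebra R G}
    (hφ : GroupNormalized φ) : ofGroup φ ∈ Cochain R (MonoidAlgebra R G) m := by
  classical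
  intro a i hi
  rw [ofGroup_apply]
  refine Finset.sum_eq_zero fun g _ => ?_
  by_cases h : g i = 1
  · rw [hφ g i h, smul_zero]
  · rw [Finset.prod_eq_zero (Finset.mem_univ i), zero_smul]
    rw [hi, MonoidAlgebra.one_def, coord_single, if_neg (Ne.symm h)]

theorem ofGroup_mem_Cocycle {m : ℕ} {φ : (Fin m → G) → MonoidAlgebra R G}
    (hφ : GroupNormalized φ) (hd : ∀ g, groupDiff (mulAct R G) (mulAct R G) φ g = 0) :
    ofGroup φ ∈ Cocycle R (MonoidAlgebra R G) m := by
  refine mem_Cocycle.2 ⟨hφ.ofGroup_mem, onGroup_injective fun g => ?_⟩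
  rw [onGroup_diff, funext (onGroup_ofGroup φ), hd]
  rfl

/-- A group algebra over a domain in which the order of the group does not vanish has no nonzero
derivations. -/
theorem eq_zero_of_mem_Cocycle_one [IsDomain R] (hG : (Fintype.card G : R) ≠ 0)
    {f : MultilinearMap R (fun _ : Fin 1 => MonoidAlgebra R G) (MonoidAlgebra R G)}
    (hf : f ∈ Cocycle R (MonoidAlgebra R G) 1) : f = 0 := by
  -- The logarithmic derivative `g⁻¹ f(g)`: the Leibniz rule makes it additive in `g`, so the finite
  -- order of `g` forces `|G| • ψ g = 0`.
  obtain ⟨ψ, hψ⟩ : ∃ ψ : G → MonoidAlgebra R G,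
      ∀ g, ψ g = mulAct R G g⁻¹ (onGroup f fun _ => g) := ⟨_, fun _ => rfl⟩
  have Tmul : ∀ (g h : G) (a : MonoidAlgebra R G),
      mulAct R G g (mulAct R G h a) = mulAct R G (g * h) a := fun g h a => by
    rw [map_mul]; rfl
  have Tone : ∀ a : MonoidAlgebra R G, mulAct R G 1 a = a := fun a => by rw [map_one]; rfl
  have hψm : ∀ g h, ψ (g * h) = ψ g + ψ h := by
    intro g h
    have e : onGroup (diff f) ![g, h] = 0 := by rw [(mem_Cocycle.1 hf).2]; rfl
    have f1 : Fin.tail ![g, h] = fun _ => h := by funext i; fin_cases i; rfl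
    have f2 : Fin.init ![g, h] = fun _ => g := by funext i; fin_cases i; rfl
    have f3 : groupMerge 0 ![g, h] = fun _ => g * h := by funext i; fin_cases i; rfl
    have f4 : ![g, h] (Fin.last 1) = h := rfl
    rw [onGroup_diff, groupDiff, groupDiffInit, Fin.sum_univ_one, f1, f2, f3, f4] at e
    have e' : (onGroup f fun _ => g * h) =
        mulAct R G g (onGroup f fun _ => h) + mulAct R G h (onGroup f fun _ => g) := by
      rw [← sub_eq_zero, ← neg_eq_zero, ← e]
      simp
      abel
    rw [hψ, e', map_add, Tmul, Tmul, hψ, hψ, add_comm]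
    congr 3 <;> simp
  have hψp : ∀ (g : G) (k : ℕ), ψ (g ^ k) = k • ψ g := by
    intro g k
    induction k with
    | zero =>
      have := hψm 1 1
      rw [mul_one] at this
      rw [pow_zero, zero_smul]
      exact left_eq_add.1 this
    | succ k ih => rw [pow_succ, hψm, ih, succ_nsmul]
  have hψ0 : ∀ g, ψ g = 0 := by
    intro g
    have h := hψp g (Fintype.card G)
    have h1 := hψp 1 0
    rw [pow_zero, zero_smul] at h1
    rw [pow_card_eq_one, h1] at h
    ext k
    have h2 : 0 = (MonoidAlgebra.basis G R).coord k (Fintype.card G • ψ g) := by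
      rw [← h, map_zero]
    rw [map_nsmul, nsmul_eq_mul] at h2
    exact (mul_eq_zero.1 h2.symm).resolve_left hG
  refine onGroup_injective fun g => ?_
  have e : g = fun _ => g 0 := by funext i; rw [Subsingleton.elim i 0]
  have h := hψ0 (g 0)
  rw [hψ] at h
  rw [e, ← Tone (onGroup f _), ← mul_inv_cancel (g 0), ← Tmul, h, map_zero]
  rfl

end Restriction

/-! ### Iterated traces -/

section Trace

variable {R : Type*} [CommRing R] {G : Type*} [CommGroup G] [Fintype G]

/-- The iterated trace of a cochain of even degree, and zero in odd degrees. -/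
def iterTrace (R : Type*) [CommRing R] (x : G) :
    (m : ℕ) → ((Fin m → G) → MonoidAlgebra R G) → MonoidAlgebra R G
  | 0, φ => φ Fin.elim0
  | 1, _ => 0
  | m + 2, φ => iterTrace R x m (groupTrace (mulAct R G) x φ)

theorem iterTrace_add (x : G) : ∀ (m : ℕ) (φ ψ : (Fin m → G) → MonoidAlgebra R G),
    iterTrace R x m (φ + ψ) = iterTrace R x m φ + iterTrace R x m ψ
  | 0, _, _ => rfl
  | 1, _, _ => (add_zero 0).symm
  | m + 2, φ, ψ => by
    rw [iterTrace, iterTrace, iterTrace, ← iterTrace_add x m]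
    congr 1
    funext g
    simp only [groupTrace, Pi.add_apply, map_add, Finset.sum_add_distrib]

theorem iterTrace_smul (x : G) (c : MonoidAlgebra R G) :
    ∀ (m : ℕ) (φ : (Fin m → G) → MonoidAlgebra R G),
    iterTrace R x m (c • φ) = c * iterTrace R x m φ
  | 0, _ => rfl
  | 1, _ => (mul_zero c).symm
  | m + 2, φ => by
    rw [iterTrace, iterTrace, ← iterTrace_smul x c m]
    congr 1
    funext g
    simp only [groupTrace, Pi.smul_apply, smul_eq_mul, Finset.mul_sum, mulAct_apply,
      mul_left_comm c]

/-- The trace passes through the differential until the coboundary has degree two, where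
`groupTrace_groupDiff_one` supplies the factor `|G|`. A coboundary of odd degree ends in degree one,
where the iterated trace is zero. -/
theorem iterTrace_groupDiff (x : G) : ∀ (m : ℕ) (φ : (Fin m → G) → MonoidAlgebra R G),
    ∃ b, iterTrace R x (m + 1) (groupDiff (mulAct R G) (mulAct R G) φ) = Fintype.card G • b
  | 0, _ => ⟨0, by rw [smul_zero]; rfl⟩
  | 1, φ => ⟨mulAct R G x⁻¹ (φ fun _ => x), groupTrace_groupDiff_one _ _ _ _⟩
  | m + 2, φ => by
    obtain ⟨b, hb⟩ := iterTrace_groupDiff x m (groupTrace (mulAct R G) x φ)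
    refine ⟨b, ?_⟩
    rw [← hb, iterTrace]
    congr 1
    funext g
    exact groupTrace_groupDiff _ _ _ _

end Trace

open DirectSum (of)

section DegreeZero

/-! ### The Hochschild cohomology of a commutative algebra in degree zero -/

variable {R A : Type*} [CommRing R] [CommRing A] [Algebra R A]

theorem const_mem_Cocycle (a : A) : const (R := R) a ∈ Cocycle R A 0 :=
  mem_Cocycle.2 ⟨fun _ i => i.elim0, diff_eq_zero_of_comm _⟩

variable (R A) in
/-- A commutative algebra as the degree zero part of its Hochschild cohomology. -/
def constHom : A →ₐ[R] ⨁ i, HH R A i where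
  toFun a := of (HH R A) 0 (cls (const a) (const_mem_Cocycle a))
  map_one' := DirectSum.of_eq_of_gradedMonoid_eq
    (sigma_cls_eq rfl _ (const_mem 1) fun a => by rw [ev_const, ev_const, map_one])
  map_mul' a b := by
    rw [DirectSum.of_mul_of]
    exact DirectSum.of_eq_of_gradedMonoid_eq (sigma_cls_eq rfl _
      (cup_mem_Cocycle (const_mem_Cocycle a) (const_mem_Cocycle b)) fun _ => rfl)
  map_zero' := by
    have : cls (const (R := R) (0 : A)) (const_mem_Cocycle 0) = 0 := rfl
    rw [this, map_zero]
  map_add' a b := by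
    rw [← map_add]
    rfl
  commutes' r := (DirectSum.algebraMap_apply R (HH R A) r).symm

theorem constHom_apply (a : A) :
    constHom R A a = of (HH R A) 0 (cls (const a) (const_mem_Cocycle a)) := rfl

theorem domDomCongr_mem_Cocycle {k l : ℕ} (h : k = l)
    {f : MultilinearMap R (fun _ : Fin k => A) A} (hf : f ∈ Cocycle R A k) :
    f.domDomCongr (finCongr h) ∈ Cocycle R A l := by
  subst h
  exact hf

theorem exists_const (y : HH R A 0) : ∃ a, of (HH R A) 0 y = constHom R A a := by
  obtain ⟨f, hf, rfl⟩ := exists_cls y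
  refine ⟨ev f fun _ => 0, DirectSum.of_eq_of_gradedMonoid_eq
    (sigma_cls_eq rfl hf (const_mem_Cocycle _) fun a => ?_)⟩
  rw [ev_const]
  exact ev_congr f (by simp)

theorem of_mul_constHom {m : ℕ} {f : MultilinearMap R (fun _ : Fin m => A) A}
    (hf : f ∈ Cocycle R A m) (a : A) :
    of (HH R A) m (cls f hf) * constHom R A a =
      of (HH R A) m (cls (cup f (const a)) (cup_mem_Cocycle hf (const_mem_Cocycle a))) := by
  rw [constHom_apply, DirectSum.of_mul_of]
  rfl

theorem constHom_commute (a : A) (y : ⨁ i, HH R A i) : Commute (constHom R A a) y := by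
  induction y using DirectSum.induction_on with
  | zero => exact Commute.zero_right _
  | add y z hy hz => exact hy.add_right hz
  | of m y =>
    obtain ⟨f, hf, rfl⟩ := exists_cls y
    rw [commute_iff_eq, constHom_apply, DirectSum.of_mul_of, DirectSum.of_mul_of]
    refine DirectSum.of_eq_of_gradedMonoid_eq (sigma_cls_eq (Nat.add_comm 0 m)
      (cup_mem_Cocycle (const_mem_Cocycle a) hf) (cup_mem_Cocycle hf (const_mem_Cocycle a))
      fun b => ?_)
    rw [ev_cup, ev_cup, ev_const, ev_const, mul_comm]
    simp only [zero_add]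

end DegreeZero

/-! ### The carry class and periodicity -/

section Cyclic

variable (R : Type*) [CommRing R] (n : ℕ) [NeZero n]

/-- The group algebra of the cyclic group. -/
abbrev CyclicAlgebra (R : Type*) [CommRing R] (n : ℕ) : Type _ :=
  MonoidAlgebra R (Multiplicative (ZMod n))

/-- The two-cocycle given by the carry of the addition of exponents. -/
def carryCochain : MultilinearMap R (fun _ : Fin 2 => CyclicAlgebra R n) (CyclicAlgebra R n) :=
  ofGroup fun g => carry (g 0) (g 1) • MonoidAlgebra.single (g 0 * g 1) 1

theorem onGroup_carryCochain (g : Fin 2 → Multiplicative (ZMod n)) :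
    onGroup (carryCochain R n) g =
      carry (g 0) (g 1) • MonoidAlgebra.single (g 0 * g 1) 1 :=
  onGroup_ofGroup _ g

/-- All four terms of the differential are multiples of the same group element `g_0 g_1 g_2`, and
their coefficients cancel by `carry_cocycle`. -/
theorem carryCochain_mem : carryCochain R n ∈ Cocycle R (CyclicAlgebra R n) 2 := by
  refine ofGroup_mem_Cocycle (fun g i hi => ?_) fun g => ?_
  · fin_cases i
    · have h : g 0 = 1 := hi
      rw [h, carry_one_left, zero_smul]
    · have h : g 1 = 1 := hi
      rw [h, carry_one_right, zero_smul]
  · have e := congrArg (Nat.cast : ℕ → ℤ) (carry_cocycle (g 0) (g 1) (g 2))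
    have f1 : Fin.tail g = ![g 1, g 2] := by funext i; fin_cases i <;> rfl
    have f2 : Fin.init g = ![g 0, g 1] := by funext i; fin_cases i <;> rfl
    have f3 : groupMerge 0 g = ![g 0 * g 1, g 2] := by funext i; fin_cases i <;> rfl
    have f4 : groupMerge 1 g = ![g 0, g 1 * g 2] := by funext i; fin_cases i <;> rfl
    have f5 : g (Fin.last 2) = g 2 := rfl
    have f6 : g 2 * (g 0 * g 1) = g 0 * (g 1 * g 2) := by rw [mul_comm, mul_assoc]
    rw [groupDiff, groupDiffInit, Fin.sum_univ_two, f1, f2, f3, f4, f5]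
    simp only [map_nsmul, mulAct_apply, MonoidAlgebra.single_mul_single, one_mul,
      Matrix.cons_val_zero, Matrix.cons_val_one, f6, mul_assoc]
    simp only [← natCast_zsmul, smul_smul, ← add_smul]
    push_cast at e
    convert zero_smul ℤ (MonoidAlgebra.single (g 0 * (g 1 * g 2)) (1 : R))
    simp
    linarith

/-- The class of the carry cocycle. -/
def carryClass : HH R (CyclicAlgebra R n) 2 := cls (carryCochain R n) (carryCochain_mem R n)

/-- The cochain `g ↦ expo g • g` would be the Euler derivation if exponents added without carry; its
failure to be one is `n` times the carry. -/
theorem card_smul_carryCochain_mem : n • carryCochain R n ∈ Coboundary R (CyclicAlgebra R n) 2 := by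
  refine ⟨ofGroup fun g => expo (g 0) • MonoidAlgebra.single (g 0) 1,
    GroupNormalized.ofGroup_mem fun g i hi => ?_, onGroup_injective fun g => ?_⟩
  · obtain rfl : i = 0 := Subsingleton.elim _ _
    rw [hi, expo_one, zero_smul]
  · change onGroup (diff _) g = n • onGroup (carryCochain R n) g
    have e := congrArg (Nat.cast : ℕ → ℤ) (carry_add (g 0) (g 1))
    have f3 : groupMerge 0 g = fun _ => g 0 * g 1 := by funext i; fin_cases i; rfl
    have f5 : g (Fin.last 1) = g 1 := rfl
    rw [onGroup_diff, funext (onGroup_ofGroup _), onGroup_carryCochain, groupDiff, groupDiffInit,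
      Fin.sum_univ_one, f3, f5]
    simp only [map_nsmul, mulAct_apply, MonoidAlgebra.single_mul_single, one_mul, Fin.tail,
      Fin.init, Fin.succ_zero_eq_one, Fin.castSucc_zero, mul_comm (g 1) (g 0)]
    simp only [← natCast_zsmul, smul_smul, ← add_smul]
    congr 1
    push_cast at e ⊢
    simp
    linarith

theorem card_mul_carryClass :
    (n : ⨁ i, HH R (CyclicAlgebra R n) i) * of (HH R (CyclicAlgebra R n)) 2 (carryClass R n) = 0 := by
  rw [← nsmul_eq_mul, ← map_nsmul]
  have : n • carryClass R n = 0 := (Submodule.Quotient.mk_eq_zero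
    (B R (CyclicAlgebra R n) 2)).2 (card_smul_carryCochain_mem R n)
  rw [this, map_zero]

variable {R n}

/-- Every class of degree `m + 2` is a multiple of the carry class. -/
theorem exists_carryClass_mul {m : ℕ} (y : HH R (CyclicAlgebra R n) (m + 2)) :
    ∃ w : HH R (CyclicAlgebra R n) m, of (HH R (CyclicAlgebra R n)) (m + 2) y =
      of (HH R (CyclicAlgebra R n)) 2 (carryClass R n) * of (HH R (CyclicAlgebra R n)) m w := by
  obtain ⟨f, hf, rfl⟩ := exists_cls y
  obtain ⟨c, u, hc, hu, hcd, h⟩ := exists_carry_of_groupDiff_eq_zero m (mulAct R _) (mulAct R _)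
    mulAct_comm (onGroup f) (GroupNormalized.onGroup hf.1) (fun g => by
      rw [← onGroup_diff, (mem_Cocycle.1 hf).2]; rfl)
  have hC := ofGroup_mem_Cocycle hc hcd
  have hU : diff (ofGroup u) ∈ Coboundary R (CyclicAlgebra R n) (m + 2) :=
    ⟨ofGroup u, hu.ofGroup_mem, rfl⟩
  -- The cup product has degree `2 + m` and not `m + 2`; reindexing the arguments makes the two
  -- sides comparable.
  have key : f - diff (ofGroup u) = (cup (carryCochain R n) (ofGroup c)).domDomCongr
      (finCongr (Nat.add_comm 2 m)) := by
    refine onGroup_injective fun g => ?_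
    have e1 : onGroup (f - diff (ofGroup u)) g = onGroup f g - onGroup (diff (ofGroup u)) g := rfl
    have e2 : onGroup ((cup (carryCochain R n) (ofGroup c)).domDomCongr
        (finCongr (Nat.add_comm 2 m))) g =
        onGroup (carryCochain R n) (fun i => g (finCongr (Nat.add_comm 2 m) (Fin.castAdd m i))) *
        onGroup (ofGroup c) (fun i => g (finCongr (Nat.add_comm 2 m) (Fin.natAdd 2 i))) := rfl
    have e3 : ∀ i : Fin m, finCongr (Nat.add_comm 2 m) (Fin.natAdd 2 i) = i.succ.succ := by
      intro i
      ext
      simp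
    rw [e1, e2, h, onGroup_diff, funext (onGroup_ofGroup u), add_sub_cancel_right,
      onGroup_carryCochain, onGroup_ofGroup, mulAct_apply, smul_mul_assoc]
    simp only [e3]
    rfl
  have hf' : f - diff (ofGroup u) ∈ Cocycle R (CyclicAlgebra R n) (m + 2) := by
    rw [key]
    exact domDomCongr_mem_Cocycle (Nat.add_comm 2 m) (cup_mem_Cocycle (carryCochain_mem R n) hC)
  have e : cls f hf = cls _ hf' := by
    rw [cls_eq_cls, sub_sub_cancel]
    exact hU
  refine ⟨cls (ofGroup c) hC, ?_⟩
  rw [e, carryClass, DirectSum.of_mul_of]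
  refine DirectSum.of_eq_of_gradedMonoid_eq (sigma_cls_eq (Nat.add_comm m 2) hf'
    (cup_mem_Cocycle (carryCochain_mem R n) hC) fun a => ?_)
  rw [key]
  rfl

end Cyclic

/-! ### Vanishing in odd degrees, generators and commutativity -/

section Structure

variable {R : Type*} [CommRing R] [IsDomain R] {n : ℕ} [NeZero n]

theorem HH_one_eq_zero (hn : (n : R) ≠ 0) (y : HH R (CyclicAlgebra R n) 1) : y = 0 := by
  obtain ⟨f, hf, rfl⟩ := exists_cls y
  have hc : (Fintype.card (Multiplicative (ZMod n)) : R) ≠ 0 := by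
    rwa [Fintype.card_multiplicative, ZMod.card]
  obtain rfl := eq_zero_of_mem_Cocycle_one hc hf
  rfl

/-- Periodicity descends by two degrees to degree zero, which is the group algebra, or to degree
one, which vanishes. -/
theorem exists_carryClass_pow_mul (hn : (n : R) ≠ 0) : ∀ (m : ℕ) (y : HH R (CyclicAlgebra R n) m),
    (∃ k a, m = 2 * k ∧ of (HH R (CyclicAlgebra R n)) m y =
      of (HH R (CyclicAlgebra R n)) 2 (carryClass R n) ^ k * constHom R (CyclicAlgebra R n) a) ∨
    Odd m ∧ y = 0
  | 0, y => by
    obtain ⟨a, ha⟩ := exists_const y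
    exact Or.inl ⟨0, a, rfl, by rw [ha, pow_zero, one_mul]⟩
  | 1, y => Or.inr ⟨odd_one, HH_one_eq_zero hn y⟩
  | m + 2, y => by
    obtain ⟨w, hw⟩ := exists_carryClass_mul y
    rcases exists_carryClass_pow_mul hn m w with ⟨k, a, rfl, h⟩ | ⟨hm, rfl⟩
    · exact Or.inl ⟨k + 1, a, by ring, by rw [hw, h, pow_succ', mul_assoc]⟩
    · refine Or.inr ⟨by rcases hm with ⟨c, rfl⟩; exact ⟨c + 1, by ring⟩, ?_⟩
      apply DirectSum.of_injective (β := HH R (CyclicAlgebra R n))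
      rw [hw, map_zero, map_zero, mul_zero]

theorem HH_eq_zero_of_odd (hn : (n : R) ≠ 0) {m : ℕ} (hm : Odd m)
    (y : HH R (CyclicAlgebra R n) m) : y = 0 := by
  rcases exists_carryClass_pow_mul hn m y with ⟨k, _, rfl, -⟩ | ⟨-, h⟩
  · exact absurd hm (Nat.not_odd_iff_even.2 (even_two_mul k))
  · exact h

theorem mem_Coboundary_of_odd (hn : (n : R) ≠ 0) {m : ℕ} (hm : Odd m)
    {f : MultilinearMap R (fun _ : Fin m => CyclicAlgebra R n) (CyclicAlgebra R n)}
    (hf : f ∈ Cocycle R (CyclicAlgebra R n) m) : f ∈ Coboundary R (CyclicAlgebra R n) m :=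
  (Submodule.Quotient.mk_eq_zero (B R (CyclicAlgebra R n) m)).1
    (HH_eq_zero_of_odd hn hm (cls f hf))

/-- The image of the group algebra is central already on cochains, and together with the carry class
it generates everything. So whatever commutes with the carry class is central; this is used first
for the carry class itself and then for every element. -/
theorem HH_mul_comm (hn : (n : R) ≠ 0) (x y : ⨁ i, HH R (CyclicAlgebra R n) i) :
    x * y = y * x := by
  have h : ∀ m (y : HH R (CyclicAlgebra R n) m) (z : ⨁ i, HH R (CyclicAlgebra R n) i),
      Commute (of (HH R (CyclicAlgebra R n)) 2 (carryClass R n)) z →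
      Commute (of (HH R (CyclicAlgebra R n)) m y) z := by
    intro m y z hz
    rcases exists_carryClass_pow_mul hn m y with ⟨k, a, -, h⟩ | ⟨-, rfl⟩
    · rw [h]
      exact (hz.pow_left k).mul_left (constHom_commute a z)
    · rw [map_zero]
      exact Commute.zero_left z
  have h' : ∀ y : ⨁ i, HH R (CyclicAlgebra R n) i,
      Commute (of (HH R (CyclicAlgebra R n)) 2 (carryClass R n)) y := by
    intro y
    induction y using DirectSum.induction_on with
    | zero => exact Commute.zero_right _
    | add y z hy hz => exact hy.add_right hz
    | of m y => exact (h m y _ (Commute.refl _)).symm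
  change Commute x y
  induction x using DirectSum.induction_on with
  | zero => exact Commute.zero_left _
  | add x z hx hz => exact hx.add_left hz
  | of m x => exact h m x y (h' y)

/-- The Hochschild cohomology of the group algebra of a cyclic group as a commutative ring. -/
abbrev commRingHH (hn : (n : R) ≠ 0) : CommRing (⨁ i, HH R (CyclicAlgebra R n) i) :=
  { (inferInstance : Ring (⨁ i, HH R (CyclicAlgebra R n) i)) with
    mul_comm := HH_mul_comm hn }

end Structure

/-! ### The trace of a cup product with the carry cocycle -/

section TraceOfCup

variable {R : Type*} [CommRing R] {n : ℕ} [NeZero n]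

/-- Sum `carry_add h x` over `h`: translation by `x` permutes the exponents, so what remains is `n`
times the claim. -/
theorem sum_carry (x : Multiplicative (ZMod n)) :
    ∑ h : Multiplicative (ZMod n), carry h x = expo x := by
  have hpos : 0 < n := Nat.pos_of_ne_zero (NeZero.ne n)
  have h1 : ∑ h : Multiplicative (ZMod n), expo (h * x) = ∑ h : Multiplicative (ZMod n), expo h :=
    Fintype.sum_equiv (Equiv.mulRight x) _ _ fun _ => rfl
  have h2 : ∑ h : Multiplicative (ZMod n), (n * carry h x + expo (h * x)) =
      ∑ h : Multiplicative (ZMod n), (expo h + expo x) :=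
    Finset.sum_congr rfl fun h _ => carry_add h x
  rw [Finset.sum_add_distrib, Finset.sum_add_distrib, h1, Finset.sum_const, Finset.card_univ,
    Fintype.card_multiplicative, ZMod.card, ← Finset.mul_sum, smul_eq_mul] at h2
  refine Nat.eq_of_mul_eq_mul_left hpos ?_
  omega

/-- The factor `(h x)⁻¹` of the trace cancels the group element `h x` in the carry cocycle, and
`sum_carry` adds up the coefficients. -/
theorem groupTrace_cup_carryCochain (x : Multiplicative (ZMod n)) {m : ℕ}
    (f : MultilinearMap R (fun _ : Fin m => CyclicAlgebra R n) (CyclicAlgebra R n)) :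
    groupTrace (mulAct R _) x (onGroup (cup f (carryCochain R n))) =
      ((expo x : ℕ) : CyclicAlgebra R n) • onGroup f := by
  funext g
  have e : ∀ h, onGroup (cup f (carryCochain R n))
      (Fin.snoc (Fin.snoc g h : Fin (m + 1) → _) x : Fin (m + 2) → _) =
      onGroup f g * onGroup (carryCochain R n) ![h, x] := by
    intro h
    have e1 : ∀ i : Fin m, (Fin.snoc (Fin.snoc g h : Fin (m + 1) → _) x : Fin (m + 2) → _)
        (Fin.castAdd 2 i) = g i := by
      intro i
      have : Fin.castAdd 2 i = i.castSucc.castSucc := rfl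
      rw [this, Fin.snoc_castSucc, Fin.snoc_castSucc]
    have e2 : ∀ i : Fin 2, (Fin.snoc (Fin.snoc g h : Fin (m + 1) → _) x : Fin (m + 2) → _)
        (Fin.natAdd m i) = ![h, x] i := by
      intro i
      fin_cases i
      · have : Fin.natAdd m (0 : Fin 2) = (Fin.last m).castSucc := rfl
        change (Fin.snoc _ x : Fin (m + 2) → _) (Fin.natAdd m (0 : Fin 2)) = h
        rw [this, Fin.snoc_castSucc, Fin.snoc_last]
      · exact Fin.snoc_last _ _
    unfold onGroup
    rw [cup_apply]
    simp only [e1, e2]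
  simp only [groupTrace, e, onGroup_carryCochain, mulAct_apply, Pi.smul_apply, smul_eq_mul,
    Matrix.cons_val_zero, Matrix.cons_val_one]
  have e3 : ∀ h : Multiplicative (ZMod n), (MonoidAlgebra.single (h * x)⁻¹ 1 : CyclicAlgebra R n) *
      (onGroup f g * carry h x • MonoidAlgebra.single (h * x) 1) =
      (carry h x : CyclicAlgebra R n) * onGroup f g := by
    intro h
    rw [nsmul_eq_mul, mul_left_comm, mul_left_comm _ ((carry h x : ℕ) : CyclicAlgebra R n),
      MonoidAlgebra.single_mul_single, inv_mul_cancel, one_mul, ← MonoidAlgebra.one_def, mul_one,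
      mul_comm]
  simp only [e3]
  rw [← Finset.sum_mul, ← Nat.cast_sum, sum_carry]

end TraceOfCup

/-! ### The left inverse of the presentation map -/

section Inverse

variable {R : Type*} [CommRing R] {n : ℕ} [NeZero n] {Q : Type*} [CommRing Q] [Algebra R Q]
  (ι : CyclicAlgebra R n →ₐ[R] Q) (z : Q)

/-- Makes the evaluation well defined on classes. The iterated trace of a coboundary is a multiple
of `n`, and from degree two on the exponent `m / 2` is positive, so that one factor `z` absorbs `n`.
In degrees zero and one the trace is itself zero. -/
theorem iterTrace_mul_pow_eq_zero (hz : (n : Q) * z = 0) {m : ℕ}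
    {f : MultilinearMap R (fun _ : Fin m => CyclicAlgebra R n) (CyclicAlgebra R n)}
    (hf : f ∈ Coboundary R (CyclicAlgebra R n) m) :
    ι (iterTrace R (gen n) m (onGroup f)) * z ^ (m / 2) = 0 := by
  cases m with
  | zero =>
    obtain rfl := Coboundary_zero hf
    have : iterTrace R (gen n) 0 (onGroup
      (0 : MultilinearMap R (fun _ : Fin 0 => CyclicAlgebra R n) (CyclicAlgebra R n))) = 0 := rfl
    rw [this, map_zero, zero_mul]
  | succ m =>
    obtain ⟨u, -, rfl⟩ := hf
    change ι (iterTrace R (gen n) (m + 1) (onGroup (diff u))) * _ = 0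
    obtain ⟨b, hb⟩ := iterTrace_groupDiff (R := R) (gen n) m (onGroup u)
    cases m with
    | zero =>
      have : iterTrace R (gen n) (0 + 1) (onGroup (diff u)) = 0 := rfl
      rw [this, map_zero, zero_mul]
    | succ m =>
      rw [funext (onGroup_diff u), hb, Fintype.card_multiplicative, ZMod.card, map_nsmul,
        show (m + 1 + 1) / 2 = m / 2 + 1 by omega, nsmul_eq_mul, pow_succ', mul_mul_mul_comm, hz,
        zero_mul]

variable (hz : (n : Q) * z = 0)

/-- The map from the Hochschild cohomology to `Q` which sends a class `a z^k` of degree `2k` to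
`ι(a) z^k`. -/
def evalClass : (⨁ i, HH R (CyclicAlgebra R n) i) →ₗ[R] Q :=
  DirectSum.toModule R ℕ Q fun m => (B R (CyclicAlgebra R n) m).liftQ
    { toFun := fun f => ι (iterTrace R (gen n) m (onGroup f.1)) * z ^ (m / 2)
      map_add' := fun f g => by
        have : onGroup (f + g).1 = onGroup f.1 + onGroup g.1 := rfl
        rw [this, iterTrace_add, map_add, add_mul]
      map_smul' := fun c f => by
        have : onGroup (c • f).1 = algebraMap R (CyclicAlgebra R n) c • onGroup f.1 := by
          funext g
          rw [Pi.smul_apply, smul_eq_mul, ← Algebra.smul_def]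
          rfl
        rw [this, iterTrace_smul, map_mul, AlgHom.commutes, mul_assoc, ← Algebra.smul_def,
          RingHom.id_apply] }
    fun _ hf => iterTrace_mul_pow_eq_zero ι z hz hf

theorem evalClass_of {m : ℕ}
    {f : MultilinearMap R (fun _ : Fin m => CyclicAlgebra R n) (CyclicAlgebra R n)}
    (hf : f ∈ Cocycle R (CyclicAlgebra R n) m) :
    evalClass ι z hz (of (HH R (CyclicAlgebra R n)) m (cls f hf)) =
      ι (iterTrace R (gen n) m (onGroup f)) * z ^ (m / 2) := by
  rw [evalClass]
  exact DirectSum.toModule_lof R m (cls f hf)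

theorem evalClass_constHom (a : CyclicAlgebra R n) :
    evalClass ι z hz (constHom R (CyclicAlgebra R n) a) = ι a := by
  rw [constHom_apply, evalClass_of, pow_zero, mul_one]
  rfl

theorem evalClass_mul_constHom (y : ⨁ i, HH R (CyclicAlgebra R n) i) (a : CyclicAlgebra R n) :
    evalClass ι z hz (y * constHom R (CyclicAlgebra R n) a) = evalClass ι z hz y * ι a := by
  induction y using DirectSum.induction_on with
  | zero => rw [zero_mul, map_zero, zero_mul]
  | add x y hx hy => rw [add_mul, map_add, map_add, hx, hy, add_mul]
  | of m y =>
    obtain ⟨f, hf, rfl⟩ := exists_cls y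
    rw [of_mul_constHom, evalClass_of, evalClass_of]
    have : onGroup (cup f (const a)) = a • onGroup f := by
      funext g
      exact mul_comm _ _
    change ι (iterTrace R (gen n) m _) * z ^ (m / 2) = _
    rw [this, iterTrace_smul, map_mul]
    ring

theorem evalClass_mul_carryClass (y : ⨁ i, HH R (CyclicAlgebra R n) i) :
    evalClass ι z hz (y * of (HH R (CyclicAlgebra R n)) 2 (carryClass R n)) =
      evalClass ι z hz y * z := by
  -- For `n = 1` the generator has exponent `0` instead of `1`, but then the relation `n z = 0` says
  -- `z = 0`.
  have hz' : ((expo (gen n) : ℕ) : Q) * z = z := by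
    rcases Nat.lt_or_ge 1 n with hn | hn
    · rw [expo_gen hn, Nat.cast_one, one_mul]
    · obtain rfl : n = 1 := le_antisymm hn (Nat.pos_of_ne_zero (NeZero.ne n))
      rw [Nat.cast_one, one_mul] at hz
      rw [hz, mul_zero]
  induction y using DirectSum.induction_on with
  | zero => rw [zero_mul, map_zero, zero_mul]
  | add x y hx hy => rw [add_mul, map_add, map_add, hx, hy, add_mul]
  | of m y =>
    obtain ⟨f, hf, rfl⟩ := exists_cls y
    have e : of (HH R (CyclicAlgebra R n)) m (cls f hf) *
        of (HH R (CyclicAlgebra R n)) 2 (carryClass R n) =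
        of (HH R (CyclicAlgebra R n)) (m + 2)
          (cls (cup f (carryCochain R n)) (cup_mem_Cocycle hf (carryCochain_mem R n))) := by
      rw [DirectSum.of_mul_of]
      rfl
    rw [e, evalClass_of, evalClass_of, iterTrace, groupTrace_cup_carryCochain, iterTrace_smul,
      map_mul, map_natCast, show (m + 2) / 2 = m / 2 + 1 by omega, pow_succ, mul_assoc, mul_comm,
      mul_assoc, mul_assoc, mul_comm z, hz', mul_assoc]

end Inverse

/-! ### The presentation by two generators -/

section Presentation

variable (R : Type*) [CommRing R] (n : ℕ)

/-- The relations of the Hochschild cohomology of the group algebra of a cyclic group. -/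
abbrev relations : Ideal (MvPolynomial (Fin 2) R) :=
  Ideal.span {MvPolynomial.X 0 ^ n - 1, (n : MvPolynomial (Fin 2) R) * MvPolynomial.X 1}

theorem relations_X_zero_pow :
    (Ideal.Quotient.mk (relations R n) (MvPolynomial.X 0)) ^ n = 1 := by
  rw [← map_pow, ← map_one (Ideal.Quotient.mk (relations R n)), Ideal.Quotient.eq]
  exact Ideal.subset_span (Or.inl rfl)

theorem relations_card_mul_X_one :
    (n : MvPolynomial (Fin 2) R ⧸ relations R n) *
      Ideal.Quotient.mk (relations R n) (MvPolynomial.X 1) = 0 := by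
  rw [← map_natCast (Ideal.Quotient.mk (relations R n)), ← map_mul, Ideal.Quotient.eq_zero_iff_mem]
  exact Ideal.subset_span (Or.inr rfl)

variable [NeZero n]

/-- The homomorphism from the group algebra which sends the generator to the first variable. -/
def toPresentation : CyclicAlgebra R n →ₐ[R] MvPolynomial (Fin 2) R ⧸ relations R n :=
  MonoidAlgebra.lift R _ _
    { toFun := fun g => (Ideal.Quotient.mk (relations R n) (MvPolynomial.X 0)) ^ expo g
      map_one' := by rw [expo_one, pow_zero]
      map_mul' := fun g h => by
        rw [expo_mul, ← pow_eq_pow_mod _ (relations_X_zero_pow R n), pow_add] }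

theorem toPresentation_single (g : Multiplicative (ZMod n)) :
    toPresentation R n (MonoidAlgebra.single g 1) =
      (Ideal.Quotient.mk (relations R n) (MvPolynomial.X 0)) ^ expo g := by
  rw [toPresentation, MonoidAlgebra.lift_single, one_smul]
  rfl

theorem toPresentation_gen :
    toPresentation R n (MonoidAlgebra.single (gen n) 1) =
      Ideal.Quotient.mk (relations R n) (MvPolynomial.X 0) := by
  have h := expo_gen_pow (n := n) 1
  rw [pow_one] at h
  rw [toPresentation_single, h, ← pow_eq_pow_mod _ (relations_X_zero_pow R n), pow_one]

/-- The presentation of the Hochschild cohomology of the group algebra of a cyclic group. -/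
theorem exists_presentation [IsDomain R] (hn : (n : R) ≠ 0) :
    ∃ e : (MvPolynomial (Fin 2) R ⧸ relations R n) ≃ₐ[R] ⨁ i, HH R (CyclicAlgebra R n) i,
      e (Ideal.Quotient.mk _ (MvPolynomial.X 0)) =
        constHom R (CyclicAlgebra R n) (MonoidAlgebra.single (gen n) 1) ∧
      e (Ideal.Quotient.mk _ (MvPolynomial.X 1)) =
        of (HH R (CyclicAlgebra R n)) 2 (carryClass R n) := by
  -- Evaluation of polynomials needs a commutative target.
  let := commRingHH hn
  set ξ := constHom R (CyclicAlgebra R n) (MonoidAlgebra.single (gen n) 1) with hξ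
  set ζ := of (HH R (CyclicAlgebra R n)) 2 (carryClass R n) with hζ
  have hξp : ∀ k, ξ ^ k = constHom R (CyclicAlgebra R n) (MonoidAlgebra.single (gen n ^ k) 1) := by
    intro k
    rw [hξ, ← map_pow, MonoidAlgebra.single_pow, one_pow]
  let Φ : MvPolynomial (Fin 2) R →ₐ[R] ⨁ i, HH R (CyclicAlgebra R n) i :=
    MvPolynomial.aeval ![ξ, ζ]
  have hΦ0 : Φ (MvPolynomial.X 0) = ξ := MvPolynomial.aeval_X _ _
  have hΦ1 : Φ (MvPolynomial.X 1) = ζ := MvPolynomial.aeval_X _ _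
  have hker : ∀ p ∈ relations R n, Φ p = 0 := by
    intro p hp
    have : relations R n ≤ RingHom.ker Φ := by
      refine Ideal.span_le.2 ?_
      rintro _ (rfl | rfl)
      · change Φ _ = 0
        rw [map_sub, map_pow, hΦ0, hξp, gen_pow_card, map_one, ← MonoidAlgebra.one_def, map_one,
          sub_self]
      · change Φ _ = 0
        rw [map_mul, map_natCast, hΦ1]
        exact card_mul_carryClass R n
    exact this hp
  let Ψ := Ideal.Quotient.liftₐ (relations R n) Φ hker
  have hΨ : ∀ p, Ψ (Ideal.Quotient.mk _ p) = Φ p := fun p => rfl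
  have hz := relations_card_mul_X_one R n
  -- The evaluation is not known to be multiplicative, but it is compatible with multiplication by
  -- the two generators, which suffices for an induction on `p`. This gives injectivity.
  have hleft : ∀ p, evalClass (toPresentation R n) _ hz (Φ p) =
      Ideal.Quotient.mk (relations R n) p := by
    intro p
    induction p using MvPolynomial.induction_on with
    | C r =>
      have e1 : Φ (MvPolynomial.C r) = constHom R (CyclicAlgebra R n) (algebraMap R _ r) := by
        rw [← MvPolynomial.algebraMap_eq, AlgHom.commutes, AlgHom.commutes]
      rw [e1, evalClass_constHom, AlgHom.commutes]
      rfl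
    | add p q hp hq => rw [map_add, map_add, map_add, hp, hq]
    | mul_X p i hp =>
      have hi : i = 0 ∨ i = 1 := by omega
      rcases hi with rfl | rfl
      · rw [map_mul Φ, hΦ0, hξ]
        refine (evalClass_mul_constHom _ _ hz _ _).trans ?_
        rw [hp, toPresentation_gen, ← map_mul]
      · rw [map_mul Φ, hΦ1, hζ]
        refine (evalClass_mul_carryClass _ _ hz _).trans ?_
        rw [hp, ← map_mul]
  have hconst : ∀ a, Ψ (toPresentation R n a) = constHom R (CyclicAlgebra R n) a := by
    have : Ψ.comp (toPresentation R n) = constHom R (CyclicAlgebra R n) := by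
      refine MonoidAlgebra.algHom_ext (fun g => ?_) (Subsingleton.elim _ _)
      rw [AlgHom.comp_apply, toPresentation_single, map_pow, hΨ, hΦ0, hξp, gen_pow_expo]
    exact fun a => DFunLike.congr_fun this a
  have hbij : Function.Bijective Ψ := by
    constructor
    · intro p q hpq
      obtain ⟨p, rfl⟩ := Ideal.Quotient.mk_surjective p
      obtain ⟨q, rfl⟩ := Ideal.Quotient.mk_surjective q
      rw [hΨ, hΨ] at hpq
      rw [← hleft p, hpq, hleft]
    · intro y
      induction y using DirectSum.induction_on with
      | zero => exact ⟨0, map_zero Ψ⟩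
      | add x y hx hy =>
        obtain ⟨p, rfl⟩ := hx
        obtain ⟨q, rfl⟩ := hy
        exact ⟨p + q, map_add Ψ p q⟩
      | of m y =>
        rcases exists_carryClass_pow_mul hn m y with ⟨k, a, -, h⟩ | ⟨-, rfl⟩
        · refine ⟨Ideal.Quotient.mk _ (MvPolynomial.X 1) ^ k * toPresentation R n a, ?_⟩
          rw [map_mul, map_pow, hconst, hΨ, hΦ1]
          exact h.symm
        · exact ⟨0, by rw [map_zero, map_zero]⟩
  exact ⟨AlgEquiv.ofBijective Ψ hbij, hΦ0, hΦ1⟩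

end Presentation

/-! ### Vanishing of the bracket and of the operator -/

section Zero

variable (R : Type*) [CommRing R] [IsDomain R] (n : ℕ) [NeZero n]

/-- Parity: either one of the cocycles has odd degree and is a coboundary, or both degrees are even
and the bracket is a cocycle of odd degree. -/
theorem isInducedBracket_zero (hn : (n : R) ≠ 0) :
    IsInducedBracket (R := R) (A := CyclicAlgebra R n) 0 where
  apply_cls {k l m} h f g hf hg := by
    refine ⟨bracket_mem_Cocycle h hf hg, ?_⟩
    have hb : bracket h f g ∈ Coboundary R (CyclicAlgebra R n) m := by
      rcases Nat.even_or_odd k with hk | hk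
      · rcases Nat.even_or_odd l with hl | hl
        · refine mem_Coboundary_of_odd hn ?_ (bracket_mem_Cocycle h hf hg)
          obtain ⟨a, rfl⟩ := hk
          obtain ⟨b, rfl⟩ := hl
          -- The truncated subtraction is harmless: `m + 1 = k + l` rules out `a + b = 0`.
          exact ⟨a + b - 1, by omega⟩
        · exact bracket_mem_Coboundary_right h hf (mem_Coboundary_of_odd hn hl hg)
      · exact bracket_mem_Coboundary_left h (mem_Coboundary_of_odd hn hk hf) hg
    have : cls (bracket h f g) (bracket_mem_Cocycle h hf hg) = 0 :=
      (Submodule.Quotient.mk_eq_zero (B R (CyclicAlgebra R n) m)).2 hb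
    rw [this, map_zero]
    rfl
  apply_zero _ _ := rfl

/-- One of the degrees `m + 1` and `m` is odd, so either the argument or the value is a coboundary;
the choice of the form plays no role. -/
theorem isInducedDelta_zero (hn : (n : R) ≠ 0) {ι : Type*} [Fintype ι]
    (F : SymmetricForm R (CyclicAlgebra R n) ι) :
    IsInducedDelta (R := R) (A := CyclicAlgebra R n) F 0 where
  apply_cls {m} f hf := by
    refine ⟨F.bv_mem_Cocycle hf, ?_⟩
    have hb : F.bv f ∈ Coboundary R (CyclicAlgebra R n) m := by
      rcases Nat.even_or_odd m with hm | hm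
      · exact F.bv_mem_Coboundary (mem_Coboundary_of_odd hn hm.add_one hf)
      · exact mem_Coboundary_of_odd hn hm (F.bv_mem_Cocycle hf)
    have : cls (F.bv f) (F.bv_mem_Cocycle hf) = 0 :=
      (Submodule.Quotient.mk_eq_zero (B R (CyclicAlgebra R n) m)).2 hb
    rw [this, map_zero]
    rfl
  apply_zero _ := rfl

/-- The only axiom with content is graded commutativity: the sign is trivial when `i` is even, and
for odd `i` the element is zero. -/
theorem isBVAlgebra_zero (hn : (n : R) ≠ 0) :
    IsBVAlgebra (R := R) (H := HH R (CyclicAlgebra R n)) 0 0 where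
  mul_comm {i j} a b := by
    rcases Nat.even_or_odd i with hi | hi
    · rw [(hi.mul_right j).neg_one_pow, one_smul, HH_mul_comm hn]
    · rw [HH_eq_zero_of_odd hn hi a, map_zero, zero_mul, mul_zero, smul_zero]
  degree _ _ _ := ⟨0, by simp⟩
  degree_zero _ _ := rfl
  antisymm _ _ := by simp
  jacobi _ _ _ := by simp
  poisson _ _ _ := by simp
  delta_degree _ := ⟨0, by simp⟩
  delta_degree_zero _ := rfl
  delta_delta _ := rfl
  bracket_eq _ _ := by simp

end Zero

end Hochschild

end

theorem mainTheorem4 (R : Type*) [CommRing R] [IsDomain R] (n : ℕ) [NeZero n]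
    (hn : ¬ ringChar R ∣ n) :
    ∃ (br : (⨁ i, Hochschild.HH R (MonoidAlgebra R (Multiplicative (ZMod n))) i) →ₗ[R]
          (⨁ i, Hochschild.HH R (MonoidAlgebra R (Multiplicative (ZMod n))) i) →ₗ[R]
          ⨁ i, Hochschild.HH R (MonoidAlgebra R (Multiplicative (ZMod n))) i)
      (Δ : (⨁ i, Hochschild.HH R (MonoidAlgebra R (Multiplicative (ZMod n))) i) →ₗ[R]
          ⨁ i, Hochschild.HH R (MonoidAlgebra R (Multiplicative (ZMod n))) i),
      Hochschild.IsInducedBracket br ∧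
      Hochschild.IsInducedDelta (Hochschild.canonicalForm R (Multiplicative (ZMod n))) Δ ∧
      Hochschild.IsBVAlgebra br Δ ∧
      (∃ e : (MvPolynomial (Fin 2) R ⧸
            (Ideal.span {MvPolynomial.X 0 ^ n - 1, (n : MvPolynomial (Fin 2) R) * MvPolynomial.X 1} :
              Ideal (MvPolynomial (Fin 2) R))) ≃ₐ[R]
          ⨁ i, Hochschild.HH R (MonoidAlgebra R (Multiplicative (ZMod n))) i,
        (∃ x, e (Ideal.Quotient.mk _ (MvPolynomial.X 0)) =
          DirectSum.of (Hochschild.HH R (MonoidAlgebra R (Multiplicative (ZMod n)))) 0 x) ∧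
        (∃ z, e (Ideal.Quotient.mk _ (MvPolynomial.X 1)) =
          DirectSum.of (Hochschild.HH R (MonoidAlgebra R (Multiplicative (ZMod n)))) 2 z)) ∧
      ∀ a, Δ a = 0 := by
  have hn' : (n : R) ≠ 0 := fun h => hn ((ringChar.spec R n).1 h)
  obtain ⟨e, h0, h1⟩ := Hochschild.exists_presentation R n hn'
  exact ⟨0, 0, Hochschild.isInducedBracket_zero R n hn', Hochschild.isInducedDelta_zero R n hn' _,
    Hochschild.isBVAlgebra_zero R n hn', ⟨e, ⟨_, h0⟩, ⟨_, h1⟩⟩, fun _ => rfl⟩
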